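/- Let $M$ be a smooth 4-manifold (Hausdorff, second countable, without boundary), $E\to M$ a rank 3 real vector bundle with smooth $\mathrm{SO}(3)$-valued transition functions, and $A$ a smooth $\mathrm{SO}(3)$ connection on $E$, given in local trivialisations by 1-forms $A^i$, $i=1,2,3$, with curvature $F^i=dA^i+\tfrac12\epsilon^{ijk}A^j\wedge A^k$ and covariant derivative $d_Ay^i=dy^i+\epsilon^{ijk}A^jy^k$ of the fibre coordinates $y^i$ (here $\epsilon^{ijk}$ is the totally antisymmetric symbol, and repeated indices are summed). Assume that $A$ is definite: there is a nowhere vanishing 4-form $\epsilon$ on $M$ such that the symmetric matrix $X$ defined by $F^i\wedge F^j=-2X^{ij}\epsilon$ is positive definite at every point; orient $M$ by $\epsilon$. Let $\sigma=\pm1$ be the sign of $A$: relative to this orientation, the form $(\xi,\eta)\mapsto\frac{\sigma}{6}\epsilon^{ijk}\,i_\xi F^i\wedge i_\eta F^j\wedge F^k$ is positive definite at every point of $M$. Put $y^2=\sum_i(y^i)^2$ and $E_\sigma=\{1+\sigma y^2>0\}\subset E$ (all of $E$ for $\sigma=1$, the open unit disc bundle for $\sigma=-1$), and consider on $E_\sigma$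 the 3-form $$\Omega=\tfrac16(1+\sigma y^2)^{-3/4}\epsilon^{ijk}\,d_Ay^i\wedge d_Ay^j\wedge d_Ay^k+2\sigma(1+\sigma y^2)^{1/4}\,d_Ay^i\wedge F^i .$$ Then at every point of $E_\sigma$ the form $\Omega$ determines a Riemannian metric $g_\Omega$, i.e. there is exactly one inner product of the form $g_\Omega=\sum_{I=1}^7\theta^I\otimes\theta^I$, where $\theta^1,\dots,\theta^7$ is a coframe with $$\Omega=\theta^5\wedge\theta^6\wedge\theta^7+\theta^5\wedge(\theta^1\wedge\theta^2-\theta^3\wedge\theta^4)+\theta^6\wedge(\theta^1\wedge\theta^3-\theta^4\wedge\theta^2)+\theta^7\wedge(\theta^1\wedge\theta^4-\theta^2\wedge\theta^3).$$ The total volume $S[\Omega]\in[0,\infty]$ of $E_\sigma$ with respect to $g_\Omega$ satisfies, as an identity in $[0,\infty]$ (with $\infty\cdot0=0$), $$S[\Omega]=4\int_{\{y\in\mathbb R^3:\,1+\sigma y^2>0\}}(1+\sigma y^2)^{1/4}\,d^3y\;\cdot\int_M(\det X)^{1/3}\,\epsilon .$$ If $\sigma=-1$, the fibre integral is finite, and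 $$S[\Omega]=\frac{16\sqrt\pi\,\Gamma(1/4)^2}{21\sqrt2}\int_M(\det X)^{1/3}\,\epsilon .$$ -/

import Mathlib

open Bundle MeasureTheory Set
open scoped Manifold ContDiff Matrix ENNReal

noncomputable section

namespace G2Lift

/-- Model space of the 4-dimensional base. -/
abbrev R4 := EuclideanSpace ℝ (Fin 4)

/-- Typical fibre of the rank 3 bundle, with coordinates `y 0, y 1, y 2`; its inner product is
written `⬝ᵥ` and its cross product `⨯₃`. -/
abbrev R3 := Fin 3 → ℝ

/-! ### Exterior algebra

Forms are given by their values on tangent vectors, and the wedge products carry the usual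
normalisation `(a ∧ b)(v, w) = a v * b w - a w * b v`. -/

section Wedge

variable {T : Type*}

/-- The wedge product of two 1-forms. -/
def wedge11 (a b : T → ℝ) (v w : T) : ℝ := a v * b w - a w * b v

/-- The wedge product of a 1-form and a 2-form. -/
def wedge12 (a : T → ℝ) (b : T → T → ℝ) (u v w : T) : ℝ :=
  a u * b v w + a v * b w u + a w * b u v

/-- The wedge product of two 2-forms. -/
def wedge22 (a b : T → T → ℝ) (v : Fin 4 → T) : ℝ :=
  a (v 0) (v 1) * b (v 2) (v 3) - a (v 0) (v 2) * b (v 1) (v 3) + a (v 0) (v 3) * b (v 1) (v 2)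
    + a (v 1) (v 2) * b (v 0) (v 3) - a (v 1) (v 3) * b (v 0) (v 2) + a (v 2) (v 3) * b (v 0) (v 1)

/-- The sum `ε^{ijk} f i j k`, where `ε` is the totally antisymmetric symbol. -/
def epsSum (f : Fin 3 → Fin 3 → Fin 3 → ℝ) : ℝ :=
  ∑ s : Equiv.Perm (Fin 3), ((Equiv.Perm.sign s : ℤ) : ℝ) * f (s 0) (s 1) (s 2)

/-- The three 2-forms `Σ¹ = θ¹∧θ² - θ³∧θ⁴`, `Σ² = θ¹∧θ³ - θ⁴∧θ²`, `Σ³ = θ¹∧θ⁴ - θ²∧θ³`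
(the 1-form `θ^I` is `t (I - 1)`). -/
def asdForm (t : Fin 7 → T → ℝ) (i : Fin 3) (v w : T) : ℝ :=
  ![wedge11 (t 0) (t 1) v w - wedge11 (t 2) (t 3) v w,
    wedge11 (t 0) (t 2) v w - wedge11 (t 3) (t 1) v w,
    wedge11 (t 0) (t 3) v w - wedge11 (t 1) (t 2) v w] i

/-- The canonical 3-form `θ⁵∧θ⁶∧θ⁷ + θ⁵∧Σ¹ + θ⁶∧Σ² + θ⁷∧Σ³`. -/
def canonicalForm (t : Fin 7 → T → ℝ) (u v w : T) : ℝ :=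
  wedge12 (t 4) (wedge11 (t 5) (t 6)) u v w
    + wedge12 (t 4) (asdForm t 0) u v w
    + wedge12 (t 5) (asdForm t 1) u v w
    + wedge12 (t 6) (asdForm t 2) u v w

/-- `g` is the Riemannian metric `g_Ω` determined by the 3-form `Ω` on a 7-dimensional tangent
space: there is a coframe `θ¹, …, θ⁷` in which `Ω` has the canonical form, and
`g = ∑ θ^I ⊗ θ^I`. -/
def IsG2Metric [AddCommGroup T] [Module ℝ T] (Om : T → T → T → ℝ)
    (g : LinearMap.BilinForm ℝ T) : Prop :=
  ∃ t : T ≃ₗ[ℝ] (Fin 7 → ℝ),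
    (∀ u v w, Om u v w = canonicalForm (fun I x => t x I) u v w) ∧
    ∀ v w, g v w = ∑ I, t v I * t w I

end Wedge

/-! ### Integration of densities -/

section Density

variable {E H M κ : Type*} [NormedAddCommGroup E] [NormedSpace ℝ E] [MeasurableSpace E]
  [BorelSpace E] [TopologicalSpace H] [TopologicalSpace M] [ChartedSpace H M] [MeasurableSpace M]
  [Fintype κ]

/-- The integral over `U` of a non-negative density `ρ` on a manifold without boundary, where
`ρ x v` is the value of the density on the frame `v` of the tangent space at `x`.  Every chart `φ`
of the atlas gives the measure on its domain whose density in the coordinates is `ρ` evaluated on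
the coordinate frame (the basis `b`, for which the unit cube of coordinate space has measure one);
these measures agree on overlaps, and their supremum is the measure that they glue to. -/
def densityIntegral (I : ModelWithCorners ℝ E H) (b : Module.Basis κ ℝ E) (U : Set M)
    (ρ : ∀ x : M, (κ → TangentSpace I x) → ℝ) : ℝ≥0∞ :=
  (⨆ φ ∈ atlas H M,
    ((b.addHaar.restrict ((φ.extend I).target ∩ (φ.extend I).symm ⁻¹' U)).withDensity
      (fun u => ENNReal.ofReal
        (ρ ((φ.extend I).symm u) (fun k => mfderiv 𝓘(ℝ, E) I (φ.extend I).symm u (b k))))).map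
      (φ.extend I).symm) univ

/-- The total volume of `U` for the Riemannian metric `g`, the integral of `√(det g)`. -/
def riemannianVolume (I : ModelWithCorners ℝ E H) [DecidableEq κ] (b : Module.Basis κ ℝ E)
    (U : Set M) (g : ∀ x : M, LinearMap.BilinForm ℝ (TangentSpace I x)) : ℝ≥0∞ :=
  densityIntegral I b U fun x v => √(Matrix.of fun k l => g x (v k) (v l)).det

end Density

/-- The standard basis of `ℝ⁴`. -/
def stdBasis4 : Module.Basis (Fin 4) ℝ R4 := (EuclideanSpace.basisFun (Fin 4) ℝ).toBasis

/-- The standard basis of `ℝ⁴ × ℝ³`. -/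
def stdBasis7 : Module.Basis (Fin 4 ⊕ Fin 3) ℝ (R4 × R3) := stdBasis4.prod (Pi.basisFun ℝ (Fin 3))

/-- The model with corners of the 7-dimensional total space. -/
abbrev I7 : ModelWithCorners ℝ (R4 × R3) (ModelProd R4 R3) := (𝓡 4).prod 𝓘(ℝ, R3)

/-! ### SO(3) connections -/

section Connection

variable {M : Type*} [TopologicalSpace M] [ChartedSpace R4 M] {ι : Type*}

/-- The transition functions of the rank 3 vector bundle take values in SO(3): the bundle is
associated with an SO(3) bundle. -/
def IsSO3 (Z : VectorBundleCore ℝ M R3 ι) : Prop :=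
  ∀ i j, ∀ x ∈ Z.baseSet i ∩ Z.baseSet j,
    LinearMap.toMatrix' (Z.coordChange i j x : R3 →ₗ[ℝ] R3) ∈
      Matrix.specialOrthogonalGroup (Fin 3) ℝ

/-- The coordinate frame of the tangent space at `x`. -/
def frame (x : M) (k : Fin 4) : TangentSpace (𝓡 4) x := stdBasis4 k

/-- The exterior derivative at `x` of a 1-form with values in `ℝ³`, computed in the chart
around `x`. -/
def extDeriv1 (a : ∀ x : M, TangentSpace (𝓡 4) x →L[ℝ] R3) (x : M)
    (v w : TangentSpace (𝓡 4) x) : R3 :=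
  let ψ := extChartAt (𝓡 4) x
  let a' : R4 → R4 →L[ℝ] R3 := fun u => (a (ψ.symm u)).comp (mfderiv 𝓘(ℝ, R4) (𝓡 4) ψ.symm u)
  let v' : R4 := mfderiv (𝓡 4) 𝓘(ℝ, R4) ψ x v
  let w' : R4 := mfderiv (𝓡 4) 𝓘(ℝ, R4) ψ x w
  fderiv ℝ a' (ψ x) v' w' - fderiv ℝ a' (ψ x) w' v'

/-- A smooth SO(3) connection, given by its connection 1-forms `A = (A¹, A², A³)` in the local
trivialisations (with so(3) identified with `ℝ³` through the cross product).  They transform in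
such a way that the covariant derivative `dy + A × y` is independent of the trivialisation. -/
structure SO3Connection [IsManifold (𝓡 4) ∞ M] (Z : VectorBundleCore ℝ M R3 ι) where
  form : ι → ∀ x : M, TangentSpace (𝓡 4) x →L[ℝ] R3
  smooth : ∀ i, ContMDiffOn (𝓡 4) ((𝓡 4).prod 𝓘(ℝ, R4 →L[ℝ] R3)) ∞
    (fun x => TotalSpace.mk' (R4 →L[ℝ] R3)
      (E := fun x : M => TangentSpace (𝓡 4) x →L[ℝ] Bundle.Trivial M R3 x) x (form i x))
    (Z.baseSet i)
  gauge : ∀ i j, ∀ x ∈ Z.baseSet i ∩ Z.baseSet j, ∀ (v : TangentSpace (𝓡 4) x) (y : R3),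
    mvfderiv (𝓡 4) (fun x' => Z.coordChange i j x' y) x v
        + form j x v ⨯₃ Z.coordChange i j x y
      = Z.coordChange i j x (form i x v ⨯₃ y)

namespace SO3Connection

variable [IsManifold (𝓡 4) ∞ M] {Z : VectorBundleCore ℝ M R3 ι} (A : SO3Connection Z)

/-- The curvature `F^i = dA^i + (1/2) ε^{ijk} A^j ∧ A^k` in the trivialisation `a`. -/
def curvature (a : ι) (x : M) (v w : TangentSpace (𝓡 4) x) : R3 :=
  extDeriv1 (A.form a) x v w + A.form a x v ⨯₃ A.form a x w

/-- The component `F^i` at `x` of the curvature, in the preferred trivialisation around `x`. -/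
def F (i : Fin 3) (x : M) (v w : TangentSpace (𝓡 4) x) : ℝ := A.curvature (Z.indexAt x) x v w i

/-- The matrix `X` with `F^i ∧ F^j = -2 X^{ij} ε`, for a nowhere vanishing 4-form `ε`. -/
def X (ε : ∀ x : M, TangentSpace (𝓡 4) x [⋀^Fin 4]→ₗ[ℝ] ℝ) (x : M) : Matrix (Fin 3) (Fin 3) ℝ :=
  Matrix.of fun i j => -(1 / 2) * wedge22 (A.F i x) (A.F j x) (frame x) / ε x (frame x)

/-- `A` is a definite connection, and `ε` is a volume form in the orientation that it provides:
`X` is positive definite. -/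
def IsDefiniteWith (ε : ∀ x : M, TangentSpace (𝓡 4) x [⋀^Fin 4]→ₗ[ℝ] ℝ) : Prop :=
  ∀ x, ε x ≠ 0 ∧ (A.X ε x).PosDef

/-- `σ = ±1` is the sign of the definite connection `A`: with respect to the orientation `ε`, the
symmetric form `(σ/6) ε^{ijk} i_ξ F^i ∧ i_η F^j ∧ F^k` is positive definite. -/
def HasSign (ε : ∀ x : M, TangentSpace (𝓡 4) x [⋀^Fin 4]→ₗ[ℝ] ℝ) (σ : ℝ) : Prop :=
  (σ = 1 ∨ σ = -1) ∧ ∀ (x : M) (ξ : TangentSpace (𝓡 4) x), ξ ≠ 0 →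
    0 < σ / 6 * epsSum (fun i j k =>
      wedge22 (wedge11 (A.F i x ξ) (A.F j x ξ)) (A.F k x) (frame x)) / ε x (frame x)

/-- The covariant derivative `d_A y = dy + A × y` of the fibre coordinates of the trivialisation
`a`, a 1-form with values in `ℝ³` on the total space. -/
def covDeriv (a : ι) (p : TotalSpace R3 Z.Fiber) (ξ : TangentSpace I7 p) : R3 :=
  mvfderiv I7 (fun q => (Z.localTriv a q).2) p ξ
    + A.form a p.proj (mfderiv I7 (𝓡 4) (π R3 Z.Fiber) p ξ) ⨯₃ (Z.localTriv a p).2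

/-- The `i`-th component of `d_A y` at `p`, in the preferred trivialisation. -/
def dAy (i : Fin 3) (p : TotalSpace R3 Z.Fiber) (ξ : TangentSpace I7 p) : ℝ :=
  A.covDeriv (Z.indexAt p.proj) p ξ i

/-- The pull-back of the curvature component `F^i` to the total space. -/
def liftF (i : Fin 3) (p : TotalSpace R3 Z.Fiber) (ξ η : TangentSpace I7 p) : ℝ :=
  A.F i p.proj (mfderiv I7 (𝓡 4) (π R3 Z.Fiber) p ξ) (mfderiv I7 (𝓡 4) (π R3 Z.Fiber) p η)

end SO3Connection

/-- The function `y² = ∑ (y^i)²` on the total space. -/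
def ySq (Z : VectorBundleCore ℝ M R3 ι) (p : TotalSpace R3 Z.Fiber) : ℝ :=
  (Z.localTriv (Z.indexAt p.proj) p).2 ⬝ᵥ (Z.localTriv (Z.indexAt p.proj) p).2

/-- The part of the total space on which the 3-form is defined: everything for `σ = 1`, and the
open unit disc bundle `y² < 1` for `σ = -1`. -/
def domain (Z : VectorBundleCore ℝ M R3 ι) (σ : ℝ) : Set (TotalSpace R3 Z.Fiber) :=
  {p | 0 < 1 + σ * ySq Z p}

variable [IsManifold (𝓡 4) ∞ M] {Z : VectorBundleCore ℝ M R3 ι}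

/-- The 3-form `(1/6) (1+σy²)^(-3/4) ε^{ijk} d_A y^i ∧ d_A y^j ∧ d_A y^k
+ 2σ (1+σy²)^(1/4) d_A y^i ∧ F^i`. -/
def Omega (A : SO3Connection Z) (σ : ℝ) (p : TotalSpace R3 Z.Fiber) (u v w : TangentSpace I7 p) :
    ℝ :=
  1 / 6 * (1 + σ * ySq Z p) ^ (-3 / 4 : ℝ) *
      epsSum (fun i j k => wedge12 (A.dAy i p) (wedge11 (A.dAy j p) (A.dAy k p)) u v w)
    + 2 * σ * (1 + σ * ySq Z p) ^ (1 / 4 : ℝ) * ∑ i, wedge12 (A.dAy i p) (A.liftF i p) u v w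

/-- The 4D action `∫_M (det X)^{1/3} ε`, where `M` is oriented by `ε`. -/
def action4 [MeasurableSpace M] (A : SO3Connection Z)
    (ε : ∀ x : M, TangentSpace (𝓡 4) x [⋀^Fin 4]→ₗ[ℝ] ℝ) : ℝ≥0∞ :=
  densityIntegral (𝓡 4) stdBasis4 (univ : Set M) fun x v => (A.X ε x).det ^ (1 / 3 : ℝ) * |ε x v|

/-- The fibre integral `∫ d³y (1+σy²)^{1/4}`. -/
def fibreIntegral (σ : ℝ) : ℝ≥0∞ :=
  ∫⁻ y in {y : R3 | 0 < 1 + σ * (y ⬝ᵥ y)}, ENNReal.ofReal ((1 + σ * (y ⬝ᵥ y)) ^ (1 / 4 : ℝ))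

end Connection

end G2Lift

end

namespace G2Lift

set_option linter.unusedSectionVars false

/-! The heart of the theorem is pointwise linear algebra. At a point of `E_σ` the projection and
`d_A y` split the tangent space as `V × ℝ³`, and there `Ω = f⁻³ dy¹∧dy²∧dy³ + 2σf dyⁱ∧Fⁱ` with `f =
(1+σy²)^(1/4)`. Write `X = R Rᵀ` with `det R > 0` and put `G = σR⁻¹F`. Then `Gⁱ∧Gʲ = -2δⁱʲε`, and
the sign condition on `A` is the orientation condition under which such a triple consists of the
forms `Σ¹, Σ², Σ³` of a coframe of `V` (`exists_asdOf_eq`). With `k = (det R)^(1/3)`, scaling that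
coframe by `√(2f²k)` and taking `(fk)⁻¹Rᵀdy` as the last three covectors puts `Ω` in canonical form.
The determinant of the coframe is `4f (det X)^(1/3) |ε|`: a function of the fibre times a density on
the base (`exists_coframe_matrices`, `exists_isG2Metric`).

Uniqueness of the metric means that a linear map `L` preserving the canonical form `φ` is
orthogonal. If `A(u)` is the matrix of `i_u φ`, then `det(A(u) + wwᵀ)² = (u·u)⁴(u·w)⁴`. Invariance
of `φ` turns this into `|det L| (Lu·Lu) = u·u`, and a determinant count gives `|det L| = 1`.

To integrate, the base is cut into countably many disjoint Borel sets, each inside a chart and a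
trivialisation (`densityIntegral_eq_tsum`). Over each piece `d_A y` acts on vertical vectors through
a matrix in SO(3), so only the Jacobian of the base chart survives (`det_splitCoord`), and Tonelli
separates the two factors. Tonelli needs the base density to be measurable, although `F` is read in
a preferred chart and trivialisation that jump from point to point. This is what the covariance of
the curvature is proved for. For `σ = -1` polar coordinates turn the fibre integral into a beta
function. -/

/-! ### The canonical 3-form determines the metric -/

/-- The matrix of the 2-form obtained by contracting the canonical 3-form on `ℝ⁷` with `u`. -/
def crossMatrix (u : Fin 7 → ℝ) : Matrix (Fin 7) (Fin 7) ℝ :=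
  !![0, u 4, u 5, u 6, -u 1, -u 2, -u 3;
     -u 4, 0, -u 6, u 5, u 0, -u 3, u 2;
     -u 5, u 6, 0, -u 4, u 3, u 0, -u 1;
     -u 6, -u 5, u 4, 0, -u 2, u 1, u 0;
     u 1, -u 0, -u 3, u 2, 0, u 6, -u 5;
     u 2, u 3, -u 0, -u 1, -u 6, 0, u 4;
     u 3, -u 2, u 1, -u 0, u 5, -u 4, 0]

theorem canonicalForm_eq_crossMatrix (u v w : Fin 7 → ℝ) :
    canonicalForm (fun I (x : Fin 7 → ℝ) => x I) u v w = v ⬝ᵥ crossMatrix u *ᵥ w := by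
  simp only [canonicalForm, wedge12, wedge11, asdForm, crossMatrix, dotProduct, Matrix.mulVec,
    Fin.sum_univ_seven, Matrix.of_apply, Matrix.cons_val]
  ring

theorem crossMatrix_transpose (u : Fin 7 → ℝ) : (crossMatrix u)ᵀ = -crossMatrix u := by
  ext i j
  fin_cases i <;> fin_cases j <;> simp [crossMatrix]

theorem crossMatrix_mulVec_self (u : Fin 7 → ℝ) : crossMatrix u *ᵥ u = 0 := by
  ext i
  fin_cases i <;> simp [crossMatrix, Matrix.mulVec, dotProduct, Fin.sum_univ_seven] <;> ring

theorem crossMatrix_vecMul_self (u : Fin 7 → ℝ) : u ᵥ* crossMatrix u = 0 := by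
  rw [← Matrix.mulVec_transpose, crossMatrix_transpose, Matrix.neg_mulVec,
    crossMatrix_mulVec_self, neg_zero]

/-- This is the double product identity `u × (u × w) = (u·w)u - (u·u)w` of the seven-dimensional
cross product. Apart from antisymmetry and `A(u)u = 0`, uniqueness of the metric uses nothing else
about the canonical form. -/
theorem crossMatrix_mul_self (u : Fin 7 → ℝ) :
    crossMatrix u * crossMatrix u = Matrix.vecMulVec u u - (u ⬝ᵥ u) • 1 := by
  ext i j
  fin_cases i <;> fin_cases j <;>
    simp [crossMatrix, Matrix.mul_apply, dotProduct, Fin.sum_univ_seven, Matrix.vecMulVec_apply]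
    <;> ring

theorem det_smul_one_add_vecMulVec {n : ℕ} (c k : ℝ) (u : Fin (n + 1) → ℝ) (hc : c ≠ 0) :
    (c • (1 : Matrix (Fin (n + 1)) (Fin (n + 1)) ℝ) + k • Matrix.vecMulVec u u).det
      = c ^ n * (c + k * (u ⬝ᵥ u)) := by
  have h : c • (1 : Matrix (Fin (n + 1)) (Fin (n + 1)) ℝ) + k • Matrix.vecMulVec u u
      = c • (1 + Matrix.replicateCol Unit ((k / c) • u) * Matrix.replicateRow Unit u) := by
    rw [← Matrix.vecMulVec_eq, Matrix.smul_vecMulVec, smul_add, smul_smul, mul_div_cancel₀ _ hc]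
  rw [h, Matrix.det_smul, Matrix.det_one_add_replicateCol_mul_replicateRow, Fintype.card_fin,
    dotProduct_smul, smul_eq_mul]
  field_simp
  ring

/-- In the product with the transpose the cross terms vanish because `u` lies in both kernels of
`crossMatrix u`. What remains is a rank-one perturbation of a scalar matrix. Squaring makes the sign
of the determinant irrelevant. -/
theorem det_crossMatrix_add_sq (u : Fin 7 → ℝ) (hu : u ≠ 0) (k : ℝ) :
    (crossMatrix u + k • Matrix.vecMulVec u u).det ^ 2 = k ^ 2 * (u ⬝ᵥ u) ^ 8 := by
  have hc : u ⬝ᵥ u ≠ 0 := fun h => hu (dotProduct_self_eq_zero.mp h)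
  have h : (crossMatrix u + k • Matrix.vecMulVec u u)
      * (crossMatrix u + k • Matrix.vecMulVec u u)ᵀ
      = (u ⬝ᵥ u) • 1 + (k ^ 2 * (u ⬝ᵥ u) - 1) • Matrix.vecMulVec u u := by
    rw [Matrix.transpose_add, crossMatrix_transpose, Matrix.transpose_smul,
      Matrix.transpose_vecMulVec, add_mul, mul_add, mul_add, mul_neg, crossMatrix_mul_self,
      mul_smul_comm, Matrix.mul_vecMulVec, crossMatrix_mulVec_self, Matrix.zero_vecMulVec,
      mul_neg, smul_mul_assoc, Matrix.vecMulVec_mul, crossMatrix_vecMul_self,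
      Matrix.vecMulVec_zero, smul_mul_assoc, mul_smul_comm, Matrix.vecMulVec_mul_vecMulVec,
      Matrix.vecMulVec_smul]
    module
  have h2 := congrArg Matrix.det h
  rw [Matrix.det_mul, Matrix.det_transpose, det_smul_one_add_vecMulVec _ _ _ hc] at h2
  rw [sq, h2]
  ring

/-- A shear reduces this to the case where `w` is a multiple of `u`. The matrix `E = 1 + x uᵀ`
preserves `crossMatrix u` under congruence since `u` is in its kernels; `x` is chosen orthogonal to
`u`, so that `det E = 1`, and such that `E w = c u`. -/
theorem det_crossMatrix_add_vecMulVec_sq (u w : Fin 7 → ℝ) (hu : u ≠ 0) (huw : u ⬝ᵥ w ≠ 0) :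
    (crossMatrix u + Matrix.vecMulVec w w).det ^ 2 = (u ⬝ᵥ u) ^ 4 * (u ⬝ᵥ w) ^ 4 := by
  have hc : u ⬝ᵥ u ≠ 0 := fun h => hu (dotProduct_self_eq_zero.mp h)
  set c := (u ⬝ᵥ w) / (u ⬝ᵥ u) with hcdef
  set x : Fin 7 → ℝ := (1 / (u ⬝ᵥ w)) • (c • u - w) with hx
  set E : Matrix (Fin 7) (Fin 7) ℝ := 1 + Matrix.vecMulVec x u with hE
  have hdet : E.det = 1 := by
    rw [hE, Matrix.vecMulVec_eq Unit, Matrix.det_one_add_replicateCol_mul_replicateRow, hx,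
      dotProduct_smul, dotProduct_sub, dotProduct_smul, hcdef, smul_eq_mul, smul_eq_mul,
      div_mul_cancel₀ _ hc]
    ring
  have hEA : E * crossMatrix u * Eᵀ = crossMatrix u := by
    rw [hE, add_mul, Matrix.vecMulVec_mul, crossMatrix_vecMul_self, Matrix.vecMulVec_zero,
      one_mul, add_zero, Matrix.transpose_add, Matrix.transpose_vecMulVec, mul_add,
      Matrix.mul_vecMulVec, crossMatrix_mulVec_self, Matrix.zero_vecMulVec,
      Matrix.transpose_one, mul_one, add_zero]
  have hEw : E *ᵥ w = c • u := by
    rw [hE, Matrix.add_mulVec, Matrix.one_mulVec, Matrix.vecMulVec_mulVec, hx]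
    ext i
    simp
    field_simp
    ring
  have h : E * (crossMatrix u + Matrix.vecMulVec w w) * Eᵀ
      = crossMatrix u + (c ^ 2) • Matrix.vecMulVec u u := by
    rw [mul_add, add_mul, hEA, Matrix.mul_vecMulVec, Matrix.vecMulVec_mul, Matrix.vecMul_transpose,
      hEw, Matrix.smul_vecMulVec, Matrix.vecMulVec_smul, smul_smul, sq]
  have h2 := congrArg (fun N => N.det ^ 2) h
  simp only [Matrix.det_mul, Matrix.det_transpose, hdet, one_mul, mul_one] at h2
  rw [h2, det_crossMatrix_add_sq u hu, hcdef]
  field_simp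

/-- The linear maps that preserve the canonical 3-form are orthogonal. -/
theorem transpose_mul_self_of_canonicalForm (L : Matrix (Fin 7) (Fin 7) ℝ) (hL : L.det ≠ 0)
    (h : ∀ u v w, canonicalForm (fun I (x : Fin 7 → ℝ) => x I) (L *ᵥ u) (L *ᵥ v) (L *ᵥ w)
      = canonicalForm (fun I (x : Fin 7 → ℝ) => x I) u v w) (u : Fin 7 → ℝ) :
    (L *ᵥ u) ⬝ᵥ (L *ᵥ u) = u ⬝ᵥ u := by
  have hA : ∀ u, Lᵀ * crossMatrix (L *ᵥ u) * L = crossMatrix u := by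
    intro u
    ext i j
    have := h u (Pi.single i 1) (Pi.single j 1)
    rw [canonicalForm_eq_crossMatrix, canonicalForm_eq_crossMatrix] at this
    have gen : ∀ N : Matrix (Fin 7) (Fin 7) ℝ,
        N i j = Pi.single i 1 ⬝ᵥ N *ᵥ Pi.single j 1 := fun N => by simp
    rw [gen (_ * L), gen (crossMatrix u), ← this, ← Matrix.mulVec_mulVec, ← Matrix.mulVec_mulVec,
      Matrix.dotProduct_mulVec _ Lᵀ, Matrix.vecMul_transpose]
  -- Add `(Lu)(Lu)ᵀ` inside the congruence `hA`. On the other side this adds `wwᵀ` with `w = LᵀLu`,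
  -- and `u·w = Lu·Lu`. Comparing squared determinants and cancelling `(Lu·Lu)⁴` leaves the claim.
  have key : ∀ u, u ≠ 0 → L.det ^ 4 * ((L *ᵥ u) ⬝ᵥ (L *ᵥ u)) ^ 4 = (u ⬝ᵥ u) ^ 4 := by
    intro u hu
    have hLu : L *ᵥ u ≠ 0 := fun h0 => hu (Matrix.eq_zero_of_mulVec_eq_zero hL h0)
    have hne : (L *ᵥ u) ⬝ᵥ (L *ᵥ u) ≠ 0 := fun h => hLu (dotProduct_self_eq_zero.mp h)
    have hdot : u ⬝ᵥ (Lᵀ *ᵥ (L *ᵥ u)) = (L *ᵥ u) ⬝ᵥ (L *ᵥ u) := by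
      rw [Matrix.dotProduct_mulVec, Matrix.vecMul_transpose]
    have e : Lᵀ * (crossMatrix (L *ᵥ u) + Matrix.vecMulVec (L *ᵥ u) (L *ᵥ u)) * L
        = crossMatrix u + Matrix.vecMulVec (Lᵀ *ᵥ (L *ᵥ u)) (Lᵀ *ᵥ (L *ᵥ u)) := by
      rw [mul_add, add_mul, hA, Matrix.mul_vecMulVec, Matrix.vecMulVec_mul,
        Matrix.mulVec_transpose]
    have e2 := congrArg (fun N => N.det ^ 2) e
    simp only [Matrix.det_mul, Matrix.det_transpose, mul_pow] at e2
    rw [det_crossMatrix_add_vecMulVec_sq _ _ hu (hdot ▸ hne), hdot,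
      det_crossMatrix_add_vecMulVec_sq _ _ hLu hne] at e2
    have : (((L *ᵥ u) ⬝ᵥ (L *ᵥ u)) ^ 4) ≠ 0 := pow_ne_zero _ hne
    apply mul_right_cancel₀ this
    linear_combination e2
  set d := |L.det| with hd
  have hdpos : 0 < d := abs_pos.mpr hL
  have key2 : ∀ u, d * ((L *ᵥ u) ⬝ᵥ (L *ᵥ u)) = u ⬝ᵥ u := by
    intro u
    by_cases hu : u = 0
    · simp [hu]
    have h4 := key u hu
    have hd4 : d ^ 4 = L.det ^ 4 := by
      rw [hd]; exact Even.pow_abs (by decide) _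
    rw [← hd4, ← mul_pow] at h4
    exact (pow_left_inj₀ (mul_nonneg hdpos.le (Finset.sum_nonneg fun i _ => mul_self_nonneg _))
      (Finset.sum_nonneg fun i _ => mul_self_nonneg _) (by norm_num)).mp h4
  have hbil : ∀ u v, d * ((L *ᵥ u) ⬝ᵥ (L *ᵥ v)) = u ⬝ᵥ v := by
    intro u v
    have h1 := key2 (u + v)
    have h2 := key2 u
    have h3 := key2 v
    simp only [Matrix.mulVec_add, add_dotProduct, dotProduct_add] at h1
    rw [dotProduct_comm v u, dotProduct_comm (L *ᵥ v) (L *ᵥ u)] at h1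
    linarith
  have hmat : d • (Lᵀ * L) = 1 := by
    ext i j
    have := hbil (Pi.single i 1) (Pi.single j 1)
    simpa [Matrix.mul_apply, Matrix.one_apply, Pi.single_apply, dotProduct, eq_comm] using this
  -- The determinant of `d LᵀL = 1` in dimension 7 reads `d⁷ d² = 1`.
  have hd1 : d = 1 := by
    have := congrArg Matrix.det hmat
    rw [Matrix.det_smul, Matrix.det_mul, Matrix.det_transpose, Matrix.det_one, ← sq, ← sq_abs,
      ← hd, Fintype.card_fin, ← pow_add] at this
    exact (pow_eq_one_iff_of_nonneg hdpos.le (by norm_num)).mp this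
  have := key2 u
  rwa [hd1, one_mul] at this

theorem isG2Metric_unique {T : Type*} [AddCommGroup T] [Module ℝ T] {Om : T → T → T → ℝ}
    {g g' : LinearMap.BilinForm ℝ T} (h : IsG2Metric Om g) (h' : IsG2Metric Om g') : g = g' := by
  obtain ⟨t, ht, hg⟩ := h
  obtain ⟨t', ht', hg'⟩ := h'
  set l : (Fin 7 → ℝ) ≃ₗ[ℝ] (Fin 7 → ℝ) := t.symm.trans t' with hl
  have hlx : ∀ x, LinearMap.toMatrix' (l : (Fin 7 → ℝ) →ₗ[ℝ] (Fin 7 → ℝ)) *ᵥ x = l x := by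
    intro x
    rw [LinearMap.toMatrix'_mulVec]
    rfl
  have hdet : (LinearMap.toMatrix' (l : (Fin 7 → ℝ) →ₗ[ℝ] (Fin 7 → ℝ))).det ≠ 0 := by
    rw [LinearMap.det_toMatrix']
    exact (LinearEquiv.isUnit_det' l).ne_zero
  have hq := transpose_mul_self_of_canonicalForm _ hdet (fun u v w => by
    have e1 := ht (t.symm u) (t.symm v) (t.symm w)
    rw [ht'] at e1
    simp only [hl]
    simpa [canonicalForm, wedge12, wedge11, asdForm] using e1)
  have hq' : ∀ z, t z ⬝ᵥ t z = t' z ⬝ᵥ t' z := by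
    intro z
    have := hq (t z)
    rw [hlx] at this
    simpa [hl] using this.symm
  ext v w
  rw [hg, hg']
  have h1 := hq' (v + w)
  have h2 := hq' v
  have h3 := hq' w
  simp only [map_add, add_dotProduct, dotProduct_add] at h1
  rw [dotProduct_comm (t w) (t v), dotProduct_comm (t' w) (t' v)] at h1
  change t v ⬝ᵥ t w = t' v ⬝ᵥ t' w
  linarith


/-! ### Triples of 2-forms on a 4-dimensional space -/

theorem epsSum_eq (f : Fin 3 → Fin 3 → Fin 3 → ℝ) :
    epsSum f = f 0 1 2 - f 0 2 1 - f 1 0 2 + f 1 2 0 + f 2 0 1 - f 2 1 0 := by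
  have h : (Finset.univ : Finset (Equiv.Perm (Fin 3))) =
      {1, Equiv.swap 1 2, Equiv.swap 0 1, Equiv.swap 0 1 * Equiv.swap 1 2,
        Equiv.swap 1 2 * Equiv.swap 0 1, Equiv.swap 0 2} := by decide
  have e1 : (Equiv.swap 1 2 : Equiv.Perm (Fin 3)) 0 = 0 := by decide
  have e2 : (Equiv.swap 0 1 : Equiv.Perm (Fin 3)) 2 = 2 := by decide
  have e3 : (Equiv.swap 0 2 : Equiv.Perm (Fin 3)) 1 = 1 := by decide
  rw [epsSum, h, Finset.sum_insert (by decide), Finset.sum_insert (by decide),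
    Finset.sum_insert (by decide), Finset.sum_insert (by decide), Finset.sum_insert (by decide),
    Finset.sum_singleton]
  simp [e1, e2, e3]
  ring

theorem epsSum_wedge111 {T : Type*} (y : Fin 3 → T → ℝ) (u v w : T) :
    epsSum (fun i j k => wedge12 (y i) (wedge11 (y j) (y k)) u v w)
      = 6 * wedge12 (y 0) (wedge11 (y 1) (y 2)) u v w := by
  rw [epsSum_eq]
  simp only [wedge12, wedge11]
  ring

/-- The 2-forms `τ⁰∧τ¹ - τ²∧τ³`, `τ⁰∧τ² - τ³∧τ¹`, `τ⁰∧τ³ - τ¹∧τ²`. -/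
def asdOf {T : Type*} (τ : Fin 4 → T → ℝ) (i : Fin 3) (v w : T) : ℝ :=
  ![wedge11 (τ 0) (τ 1) v w - wedge11 (τ 2) (τ 3) v w,
    wedge11 (τ 0) (τ 2) v w - wedge11 (τ 3) (τ 1) v w,
    wedge11 (τ 0) (τ 3) v w - wedge11 (τ 1) (τ 2) v w] i

/-- The hypothesis says that the matrix `B j ⬝ᵥ a k` is `-c` times the identity plus an
antisymmetric matrix. Expanding `B j` in the basis dual to `a`, which is `(a (k+1) ⨯₃ a (k+2)) / det
a`, the antisymmetric part becomes a cross product with a fixed vector. Multiplying through by `det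
a` gives a polynomial identity that needs no invertibility. -/
theorem cofactor_decomposition (a B : Fin 3 → Fin 3 → ℝ) (c : ℝ)
    (h : ∀ j k, B j ⬝ᵥ a k + B k ⬝ᵥ a j = if j = k then -2 * c else 0) :
    ∃ n : Fin 3 → ℝ, ∀ j, (Matrix.of a).det • B j
      = (∑ l, n l • a l) ⨯₃ a j - c • (a (j + 1) ⨯₃ a (j + 2)) := by
  refine ⟨![B 1 ⬝ᵥ a 2, B 2 ⬝ᵥ a 0, B 0 ⬝ᵥ a 1], ?_⟩
  have h00 := h 0 0
  have h11 := h 1 1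
  have h22 := h 2 2
  have h01 := h 0 1
  have h02 := h 0 2
  have h12 := h 1 2
  simp only [dotProduct, Fin.sum_univ_three, if_true, Fin.isValue, Fin.reduceEq, if_false] at *
  intro j
  ext m
  fin_cases j
  · fin_cases m
    · simp [Matrix.det_fin_three, crossProduct]
      linear_combination (1 / 2) * h00 * (a 1 1 * a 2 2 - a 1 2 * a 2 1)
        + h02 * (a 0 1 * a 1 2 - a 0 2 * a 1 1)
    · simp [Matrix.det_fin_three, crossProduct]
      linear_combination (1 / 2) * h00 * (a 1 2 * a 2 0 - a 1 0 * a 2 2)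
        + h02 * (a 0 2 * a 1 0 - a 0 0 * a 1 2)
    · simp [Matrix.det_fin_three, crossProduct]
      linear_combination (1 / 2) * h00 * (a 1 0 * a 2 1 - a 1 1 * a 2 0)
        + h02 * (a 0 0 * a 1 1 - a 0 1 * a 1 0)
  · fin_cases m
    · simp [Matrix.det_fin_three, crossProduct]
      linear_combination (1 / 2) * h11 * (a 2 1 * a 0 2 - a 2 2 * a 0 1)
        + h01 * (a 1 1 * a 2 2 - a 1 2 * a 2 1)
    · simp [Matrix.det_fin_three, crossProduct]
      linear_combination (1 / 2) * h11 * (a 2 2 * a 0 0 - a 2 0 * a 0 2)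
        + h01 * (a 1 2 * a 2 0 - a 1 0 * a 2 2)
    · simp [Matrix.det_fin_three, crossProduct]
      linear_combination (1 / 2) * h11 * (a 2 0 * a 0 1 - a 2 1 * a 0 0)
        + h01 * (a 1 0 * a 2 1 - a 1 1 * a 2 0)
  · fin_cases m
    · simp [Matrix.det_fin_three, crossProduct]
      linear_combination (1 / 2) * h22 * (a 0 1 * a 1 2 - a 0 2 * a 1 1)
        + h12 * (a 2 1 * a 0 2 - a 2 2 * a 0 1)
    · simp [Matrix.det_fin_three, crossProduct]
      linear_combination (1 / 2) * h22 * (a 0 2 * a 1 0 - a 0 0 * a 1 2)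
        + h12 * (a 2 2 * a 0 0 - a 2 0 * a 0 2)
    · simp [Matrix.det_fin_three, crossProduct]
      linear_combination (1 / 2) * h22 * (a 0 0 * a 1 1 - a 0 1 * a 1 0)
        + h12 * (a 2 0 * a 0 1 - a 2 1 * a 0 0)

section

variable {V : Type*} [AddCommGroup V] [Module ℝ V] (b : Module.Basis (Fin 4) ℝ V)

theorem alternating_bilin_eq (G : LinearMap.BilinForm ℝ V) (hG : ∀ v, G v v = 0) (v w : V) :
    G v w = G (b 0) (b 1) * wedge11 (fun x => b.repr x 0) (fun x => b.repr x 1) v w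
      + G (b 0) (b 2) * wedge11 (fun x => b.repr x 0) (fun x => b.repr x 2) v w
      + G (b 0) (b 3) * wedge11 (fun x => b.repr x 0) (fun x => b.repr x 3) v w
      + G (b 2) (b 3) * wedge11 (fun x => b.repr x 2) (fun x => b.repr x 3) v w
      - G (b 1) (b 3) * wedge11 (fun x => b.repr x 3) (fun x => b.repr x 1) v w
      + G (b 1) (b 2) * wedge11 (fun x => b.repr x 1) (fun x => b.repr x 2) v w := by
  have hs : ∀ x y, G x y = -G y x := by
    intro x y
    have := hG (x + y)
    simp only [map_add, LinearMap.add_apply, hG] at this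
    linarith
  have e : G v w = ∑ i, ∑ j, b.repr v i * (b.repr w j * G (b i) (b j)) := by
    conv_lhs => rw [← b.sum_repr v, ← b.sum_repr w]
    simp only [map_sum, map_smul, LinearMap.sum_apply, LinearMap.smul_apply, smul_eq_mul,
      Finset.mul_sum]
    rw [Finset.sum_comm]
    exact Finset.sum_congr rfl fun i _ => Finset.sum_congr rfl fun j _ => by ring
  rw [e]
  simp only [Fin.sum_univ_four, hG, wedge11]
  rw [hs (b 1) (b 0), hs (b 2) (b 0), hs (b 3) (b 0), hs (b 2) (b 1), hs (b 3) (b 1),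
    hs (b 3) (b 2)]
  ring

/-- Split each `G j` into the part `a j` containing `b 0` and the part `B j` on the other three
directions. The wedge conditions then give `B j = β × a j - q² a (j+1) × a (j+2)`, which is exactly
the shape of the three forms of the coframe `τ⁰ = q⁻¹(e⁰ + β·e)`, `τʲ⁺¹ = q (a j)·e`. The condition
on the determinant makes `q² = c / det a` positive. -/
theorem exists_asdOf_eq (G : Fin 3 → LinearMap.BilinForm ℝ V) (hG : ∀ i v, G i v v = 0) (c : ℝ)
    (hw : ∀ i j, wedge22 (fun v w => G i v w) (fun v w => G j v w) b
      = if i = j then -2 * c else 0)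
    (hdet : 0 < c * (Matrix.of fun i (k : Fin 3) => G i (b 0) (b k.succ)).det) :
    ∃ P : Matrix (Fin 4) (Fin 4) ℝ, P.det = c ∧
      ∀ j v w, asdOf (fun I v => (P *ᵥ b.repr v) I) j v w = G j v w := by
  set a : Fin 3 → Fin 3 → ℝ := fun i k => G i (b 0) (b k.succ) with ha
  set B : Fin 3 → Fin 3 → ℝ :=
    fun i => ![G i (b 2) (b 3), -G i (b 1) (b 3), G i (b 1) (b 2)] with hB
  obtain ⟨n, hn⟩ := cofactor_decomposition a B c (fun j k => by
    rw [← hw j k]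
    simp only [dotProduct, Fin.sum_univ_three, wedge22, ha, hB, Matrix.cons_val]
    simp only [show (0 : Fin 3).succ = 1 from rfl, show (1 : Fin 3).succ = 2 from rfl,
      show (2 : Fin 3).succ = 3 from rfl]
    ring)
  set d := (Matrix.of a).det with hd
  have hd0 : d ≠ 0 := fun h => by
    rw [h, mul_zero] at hdet
    exact lt_irrefl _ hdet
  have hq : 0 < c / d := by
    have : c / d = c * d / d ^ 2 := by field_simp
    rw [this]
    exact div_pos hdet (by positivity)
  set q := √(c / d) with hqdef
  have hq0 : 0 < q := Real.sqrt_pos.mpr hq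
  have hqq : q * q = c / d := Real.mul_self_sqrt hq.le
  set β : Fin 3 → ℝ := d⁻¹ • ∑ l, n l • a l with hβ
  have hBj : ∀ j, B j = β ⨯₃ a j - (q * q) • (a (j + 1) ⨯₃ a (j + 2)) := by
    intro j
    rw [hqq, hβ, map_smul, LinearMap.smul_apply, div_eq_inv_mul, mul_smul, ← smul_sub, ← hn j,
      smul_smul, inv_mul_cancel₀ hd0, one_smul]
  clear_value β
  refine ⟨!![q⁻¹, q⁻¹ * β 0, q⁻¹ * β 1, q⁻¹ * β 2; 0, q * a 0 0, q * a 0 1, q * a 0 2;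
    0, q * a 1 0, q * a 1 1, q * a 1 2; 0, q * a 2 0, q * a 2 1, q * a 2 2], ?_, ?_⟩
  · have e : c = q * q * d := by rw [hqq, div_mul_cancel₀ _ hd0]
    rw [e, hd, Matrix.det_succ_column_zero]
    simp [Fin.sum_univ_four, Matrix.det_fin_three, Matrix.submatrix_apply]
    field_simp
  · intro j v w
    rw [alternating_bilin_eq b (G j) (hG j)]
    have ha1 : ∀ i, G i (b 0) (b 1) = a i 0 := fun i => rfl
    have ha2 : ∀ i, G i (b 0) (b 2) = a i 1 := fun i => rfl
    have ha3 : ∀ i, G i (b 0) (b 3) = a i 2 := fun i => rfl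
    have hB1 : ∀ i, G i (b 2) (b 3) = B i 0 := fun i => rfl
    have hB2 : ∀ i, G i (b 1) (b 3) = -B i 1 := fun i => by simp [hB]
    have hB3 : ∀ i, G i (b 1) (b 2) = B i 2 := fun i => rfl
    rw [ha1, ha2, ha3, hB1, hB2, hB3, hBj]
    clear_value a B q
    fin_cases j <;>
    · simp [asdOf, wedge11, Matrix.mulVec, dotProduct, Fin.sum_univ_four, crossProduct]
      field_simp
      ring

end

theorem exists_mul_transpose_eq {n : ℕ} (hn : Odd n) (X : Matrix (Fin n) (Fin n) ℝ)
    (hX : X.PosDef) : ∃ R : Matrix (Fin n) (Fin n) ℝ, R * Rᵀ = X ∧ 0 < R.det := by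
  open scoped MatrixOrder in
  obtain ⟨R, hR⟩ := CStarAlgebra.nonneg_iff_eq_mul_star_self.mp hX.posSemidef.nonneg
  have hR' : R * Rᵀ = X := by
    rw [hR, Matrix.star_eq_conjTranspose, Matrix.conjTranspose_eq_transpose_of_trivial]
  have hdet : R.det ≠ 0 := fun h => by
    have := hX.det_pos
    rw [← hR', Matrix.det_mul, h, zero_mul] at this
    exact lt_irrefl _ this
  rcases hdet.lt_or_gt with h | h
  -- In odd dimension `-R` has the opposite determinant and the same product with its transpose.
  · refine ⟨-R, by simp [hR'], ?_⟩
    rw [Matrix.det_neg, Fintype.card_fin, hn.neg_one_pow]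
    linarith
  · exact ⟨R, hR', h⟩


section

variable {V : Type*} [AddCommGroup V] [Module ℝ V] (b : Module.Basis (Fin 4) ℝ V)

/-- Evaluated on `b 0`, the form defining the sign of the connection is a multiple of the
determinant that `exists_asdOf_eq` requires to have the sign of `c`. -/
theorem epsSum_contraction (F : Fin 3 → LinearMap.BilinForm ℝ V) (hF : ∀ i v, F i v v = 0) :
    epsSum (fun i j k => wedge22 (wedge11 (F i (b 0)) (F j (b 0))) (fun v w => F k v w) b)
      = 6 * (Matrix.of fun i (k : Fin 3) => F i (b 0) (b k.succ)).det := by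
  have h0 : ∀ i, F i (b 0) (b 0) = 0 := fun i => hF i _
  rw [epsSum_eq]
  simp only [wedge22, wedge11, h0, Matrix.det_fin_three, Matrix.of_apply,
    show (0 : Fin 3).succ = 1 from rfl, show (1 : Fin 3).succ = 2 from rfl,
    show (2 : Fin 3).succ = 3 from rfl]
  ring

theorem wedge22_sum (F : Fin 3 → LinearMap.BilinForm ℝ V) (p q : Fin 3 → ℝ) :
    wedge22 (fun v w => (∑ i, p i • F i) v w) (fun v w => (∑ i, q i • F i) v w) b
      = ∑ i, ∑ j, p i * q j * wedge22 (fun v w => F i v w) (fun v w => F j v w) b := by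
  simp only [wedge22, LinearMap.add_apply, LinearMap.smul_apply, smul_eq_mul, Fin.sum_univ_three]
  ring

theorem exists_coframe_matrices (F : Fin 3 → LinearMap.BilinForm ℝ V) (hF : ∀ i v, F i v v = 0)
    (c : ℝ) (X : Matrix (Fin 3) (Fin 3) ℝ) (hX : X.PosDef)
    (hw : ∀ i j, wedge22 (fun v w => F i v w) (fun v w => F j v w) b = -2 * X i j * c)
    (σ : ℝ) (hσ : σ = 1 ∨ σ = -1)
    (hs : 0 < σ / 6 * epsSum (fun i j k =>
      wedge22 (wedge11 (F i (b 0)) (F j (b 0))) (fun v w => F k v w) b) / c)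
    (f : ℝ) (hf : 0 < f) :
    ∃ (P : Matrix (Fin 4) (Fin 4) ℝ) (Q : Matrix (Fin 3) (Fin 3) ℝ),
      P.det ≠ 0 ∧ Q.det = (f ^ 3)⁻¹ ∧ |P.det| * |Q.det| = 4 * f * X.det ^ (1 / 3 : ℝ) * |c| ∧
      ∀ y v w, ∑ j, (Q *ᵥ y) j * asdOf (fun I v => (P *ᵥ b.repr v) I) j v w
        = 2 * σ * f * ∑ i, y i * F i v w := by
  have hσ2 : σ * σ = 1 := by rcases hσ with h | h <;> rw [h] <;> norm_num
  obtain ⟨R, hR, hr⟩ := exists_mul_transpose_eq (by decide) X hX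
  set r := R.det with hrdef
  have hRu : IsUnit R.det := hr.ne'.isUnit
  -- `R⁻¹` normalises `X` to the identity; the factor `σ` gives the triple `G` the orientation
  -- demanded by `exists_asdOf_eq`, and reappears as the `σ` in the mixed term of the 3-form.
  set S : Matrix (Fin 3) (Fin 3) ℝ := σ • R⁻¹ with hS
  have hSX : S * X * Sᵀ = 1 := by
    rw [← hR, hS, Matrix.transpose_smul, smul_mul_assoc, smul_mul_assoc, mul_smul_comm, smul_smul,
      hσ2, one_smul, ← mul_assoc, Matrix.nonsing_inv_mul _ hRu, one_mul, ← Matrix.transpose_mul,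
      Matrix.nonsing_inv_mul _ hRu, Matrix.transpose_one]
  have hc : c ≠ 0 := fun h => by simp [h] at hs
  rw [epsSum_contraction b F hF] at hs
  set a : Matrix (Fin 3) (Fin 3) ℝ := Matrix.of fun i (k : Fin 3) => F i (b 0) (b k.succ) with ha
  set G : Fin 3 → LinearMap.BilinForm ℝ V := fun j => ∑ i, S j i • F i with hG
  have hGalt : ∀ j v, G j v v = 0 := fun j v => by simp [hG, LinearMap.sum_apply, hF]
  have hGw : ∀ i j, wedge22 (fun v w => G i v w) (fun v w => G j v w) b
      = if i = j then -2 * c else 0 := by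
    intro i j
    have h1 := congrFun (congrFun hSX i) j
    rw [Matrix.one_apply] at h1
    simp only [Matrix.mul_apply, Matrix.transpose_apply, Fin.sum_univ_three] at h1
    rw [hG, wedge22_sum]
    simp only [hw, Fin.sum_univ_three]
    split_ifs at h1 ⊢ <;> linear_combination (-2 * c) * h1
  have hGdet : (Matrix.of fun i (k : Fin 3) => G i (b 0) (b k.succ)).det = σ / r * a.det := by
    have : (Matrix.of fun i (k : Fin 3) => G i (b 0) (b k.succ)) = S * a := by
      ext i k
      simp [hG, ha, Matrix.mul_apply, LinearMap.sum_apply]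
    rw [this, Matrix.det_mul, hS, Matrix.det_smul, Matrix.det_nonsing_inv, Fintype.card_fin,
      Ring.inverse_eq_inv', ← hrdef]
    rw [show σ ^ 3 = σ * σ * σ by ring, hσ2, one_mul, div_eq_mul_inv]
  have hpos : 0 < c * (Matrix.of fun i (k : Fin 3) => G i (b 0) (b k.succ)).det := by
    rw [hGdet]
    have : c * (σ / r * a.det) = (σ / 6 * (6 * a.det) / c) * (c ^ 2 / r) := by
      field_simp
    rw [this]
    exact mul_pos hs (div_pos (by positivity) hr)
  obtain ⟨P₀, hP₀, hasd⟩ := exists_asdOf_eq b G hGalt c hGw hpos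
  set k : ℝ := r ^ (1 / 3 : ℝ) with hk
  have hk0 : 0 < k := Real.rpow_pos_of_pos hr _
  have hk3 : k ^ 3 = r := by
    rw [hk, ← Real.rpow_natCast, ← Real.rpow_mul hr.le]
    norm_num
  have hXdet : X.det ^ (1 / 3 : ℝ) = k ^ 2 := by
    rw [← hR, Matrix.det_mul, Matrix.det_transpose, ← hrdef, Real.mul_rpow hr.le hr.le, ← hk, sq]
  -- Two conditions fix the scales: `det Q = f⁻³` forces the factor `(fk)⁻¹` in front of `Rᵀ`, and
  -- the coefficient `2σf` then forces `m² (fk)⁻¹ = 2f`. Hence `det P = m⁴c = 4f⁴k²c`, where `k² =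
  -- (det X)^(1/3)`.
  set m : ℝ := √(2 * f * (f * k)) with hm
  have hmm : m * m = 2 * f * (f * k) := Real.mul_self_sqrt (by positivity)
  have hm0 : 0 < m := Real.sqrt_pos.mpr (by positivity)
  have hQ : ((f * k)⁻¹ • Rᵀ).det = (f ^ 3)⁻¹ := by
    rw [Matrix.det_smul, Matrix.det_transpose, Fintype.card_fin, ← hrdef, ← hk3]
    field_simp
  have hP : (m • P₀).det = 4 * f ^ 4 * k ^ 2 * c := by
    rw [Matrix.det_smul, hP₀, Fintype.card_fin, show m ^ 4 = (m * m) * (m * m) by ring, hmm]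
    ring
  refine ⟨m • P₀, (f * k)⁻¹ • Rᵀ, ?_, hQ, ?_, ?_⟩
  · rw [hP]
    positivity
  · rw [hP, hQ, hXdet, abs_mul, abs_of_pos (by positivity : 0 < 4 * f ^ 4 * k ^ 2),
      abs_of_pos (by positivity : 0 < (f ^ 3)⁻¹)]
    field_simp
  · intro y v w
    have h1 : ∀ j, asdOf (fun I v => ((m • P₀) *ᵥ b.repr v) I) j v w
        = 2 * f * (f * k) * G j v w := by
      intro j
      rw [← hmm, ← hasd]
      fin_cases j <;> simp [asdOf, wedge11, Matrix.smul_mulVec] <;> ring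
    have hRS : R * S = σ • 1 := by
      rw [hS, mul_smul_comm, Matrix.mul_nonsing_inv _ hRu]
    have h3 : ∑ j, (y ᵥ* R) j * G j v w = σ * ∑ i, y i * F i v w := by
      have : ∑ j, (y ᵥ* R) j * G j v w = (y ᵥ* R) ⬝ᵥ (S *ᵥ fun i => F i v w) := by
        simp [dotProduct, hG, LinearMap.sum_apply, Matrix.mulVec]
      rw [this, Matrix.dotProduct_mulVec, Matrix.vecMul_vecMul, hRS, Matrix.vecMul_smul,
        Matrix.vecMul_one, smul_dotProduct]
      rfl
    simp only [h1]
    simp only [Matrix.smul_mulVec, Matrix.mulVec_transpose, Pi.smul_apply, smul_eq_mul]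
    calc ∑ j, (f * k)⁻¹ * (y ᵥ* R) j * (2 * f * (f * k) * G j v w)
        = 2 * f * ∑ j, (y ᵥ* R) j * G j v w := by
          rw [Finset.mul_sum]
          refine Finset.sum_congr rfl fun j _ => ?_
          field_simp
      _ = _ := by rw [h3]; ring

variable {T : Type*} [AddCommGroup T] [Module ℝ T]

/-- The coordinates of a vector in a split 7-dimensional space. -/
noncomputable def splitCoord (L : T →ₗ[ℝ] V × (Fin 3 → ℝ)) (z : T) : Fin 4 ⊕ Fin 3 → ℝ :=
  Sum.elim (b.repr (L z).1) (L z).2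

/-- The coframe is the splitting `L` followed by the block matrix `diag(P, Q)`. The Gram matrix of
`v` is `NᵀN` for the matrix `N` of coframe values, so its root determinant is `|det P| |det Q|`
times the determinant of the split coordinates. -/
theorem exists_isG2Metric (L : T ≃ₗ[ℝ] V × (Fin 3 → ℝ))
    (F : Fin 3 → LinearMap.BilinForm ℝ V) (hF : ∀ i v, F i v v = 0)
    (c : ℝ) (X : Matrix (Fin 3) (Fin 3) ℝ) (hX : X.PosDef)
    (hw : ∀ i j, wedge22 (fun v w => F i v w) (fun v w => F j v w) b = -2 * X i j * c)
    (σ : ℝ) (hσ : σ = 1 ∨ σ = -1)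
    (hs : 0 < σ / 6 * epsSum (fun i j k =>
      wedge22 (wedge11 (F i (b 0)) (F j (b 0))) (fun v w => F k v w) b) / c)
    (f : ℝ) (hf : 0 < f) :
    ∃ g, IsG2Metric (fun u v w : T =>
        1 / 6 * (f ^ 3)⁻¹ * epsSum (fun i j k => wedge12 (fun z => (L z).2 i)
            (wedge11 (fun z => (L z).2 j) (fun z => (L z).2 k)) u v w)
          + 2 * σ * f * ∑ i, wedge12 (fun z => (L z).2 i)
            (fun z z' => F i (L z).1 (L z').1) u v w) g ∧
      ∀ v : Fin 4 ⊕ Fin 3 → T, √(Matrix.of fun k l => g (v k) (v l)).det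
        = 4 * f * X.det ^ (1 / 3 : ℝ) * |c|
          * |(Matrix.of fun i k => splitCoord b L.toLinearMap (v k) i).det| := by
  obtain ⟨P, Q, hP, hQ, hPQ, hPF⟩ := exists_coframe_matrices b F hF c X hX hw σ hσ hs f hf
  have hQ0 : Q.det ≠ 0 := by rw [hQ]; positivity
  set e₁ : V ≃ₗ[ℝ] (Fin 4 → ℝ) := b.equivFun.trans
    (P.toLinearEquiv' (Matrix.invertibleOfIsUnitDet P hP.isUnit)) with he₁
  set e₂ : (Fin 3 → ℝ) ≃ₗ[ℝ] (Fin 3 → ℝ) :=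
    Q.toLinearEquiv' (Matrix.invertibleOfIsUnitDet Q hQ0.isUnit) with he₂
  set t : T ≃ₗ[ℝ] (Fin 7 → ℝ) := L.trans ((e₁.prodCongr e₂).trans
    ((LinearEquiv.sumArrowLequivProdArrow (Fin 4) (Fin 3) ℝ ℝ).symm.trans
      (LinearEquiv.funCongrLeft ℝ ℝ (finSumFinEquiv (m := 4) (n := 3)).symm))) with ht
  have ht1 : ∀ z (I : Fin 4),
      t z (finSumFinEquiv (m := 4) (n := 3) (Sum.inl I)) = (P *ᵥ b.repr (L z).1) I := fun z I => by
    rw [ht]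
    simp [e₁]
    rfl
  have ht2 : ∀ z (I : Fin 3),
      t z (finSumFinEquiv (m := 4) (n := 3) (Sum.inr I)) = (Q *ᵥ (L z).2) I := fun z I => by
    rw [ht]
    simp [e₂]
    rfl
  have t0 : ∀ z, t z 0 = (P *ᵥ b.repr (L z).1) 0 := fun z => ht1 z 0
  have t1 : ∀ z, t z 1 = (P *ᵥ b.repr (L z).1) 1 := fun z => ht1 z 1
  have t2 : ∀ z, t z 2 = (P *ᵥ b.repr (L z).1) 2 := fun z => ht1 z 2
  have t3 : ∀ z, t z 3 = (P *ᵥ b.repr (L z).1) 3 := fun z => ht1 z 3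
  have t4 : ∀ z, t z 4 = (Q *ᵥ (L z).2) 0 := fun z => ht2 z 0
  have t5 : ∀ z, t z 5 = (Q *ᵥ (L z).2) 1 := fun z => ht2 z 1
  have t6 : ∀ z, t z 6 = (Q *ᵥ (L z).2) 2 := fun z => ht2 z 2
  refine ⟨∑ I, (LinearMap.mul ℝ ℝ).compl₁₂ (LinearMap.proj I ∘ₗ t.toLinearMap)
    (LinearMap.proj I ∘ₗ t.toLinearMap), ⟨t, ?_, ?_⟩, ?_⟩
  · intro u v w
    have hasd : ∀ j v w, asdForm (fun I x => t x I) j v w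
        = asdOf (fun I v => (P *ᵥ b.repr v) I) j (L v).1 (L w).1 := by
      intro j v w
      fin_cases j <;> simp [asdForm, asdOf, wedge11, t0, t1, t2, t3]
    have hvol : wedge12 (fun z => t z 4) (wedge11 (fun z => t z 5) (fun z => t z 6)) u v w
        = Q.det * wedge12 (fun z => (L z).2 0)
          (wedge11 (fun z => (L z).2 1) (fun z => (L z).2 2)) u v w := by
      simp only [wedge12, wedge11, t4, t5, t6, Matrix.mulVec, dotProduct, Fin.sum_univ_three,
        Matrix.det_fin_three]
      ring
    beta_reduce
    rw [canonicalForm, hvol, hQ, epsSum_wedge111 (fun i z => (L z).2 i)]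
    have h1 := hPF (L u).2 (L v).1 (L w).1
    have h2 := hPF (L v).2 (L w).1 (L u).1
    have h3 := hPF (L w).2 (L u).1 (L v).1
    simp only [Fin.sum_univ_three] at h1 h2 h3 ⊢
    simp only [wedge12, hasd, t4, t5, t6]
    linear_combination -h1 - h2 - h3
  · intro v w
    simp [LinearMap.sum_apply]
  · intro v
    set K : Matrix (Fin 4 ⊕ Fin 3) (Fin 4 ⊕ Fin 3) ℝ :=
      Matrix.of fun i k => splitCoord b L.toLinearMap (v k) i with hK
    set N : Matrix (Fin 4 ⊕ Fin 3) (Fin 4 ⊕ Fin 3) ℝ := Matrix.fromBlocks P 0 0 Q * K with hN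
    have hNt : ∀ i k, N i k = t (v k) (finSumFinEquiv (m := 4) (n := 3) i) := by
      intro i k
      rcases i with i | i
      · rw [ht1, hN, Matrix.mul_apply]
        simp [Matrix.mulVec, dotProduct, hK, splitCoord]
      · rw [ht2, hN, Matrix.mul_apply]
        simp [Matrix.mulVec, dotProduct, hK, splitCoord]
    have hgram : (Matrix.of fun k l => (∑ I, (LinearMap.mul ℝ ℝ).compl₁₂
        (LinearMap.proj I ∘ₗ t.toLinearMap) (LinearMap.proj I ∘ₗ t.toLinearMap)) (v k) (v l))
        = Nᵀ * N := by
      ext k l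
      simp only [Matrix.of_apply, Matrix.mul_apply, Matrix.transpose_apply, hNt]
      rw [(finSumFinEquiv (m := 4) (n := 3)).sum_comp (fun I => t (v k) I * t (v l) I)]
      simp [LinearMap.sum_apply]
    rw [hgram, Matrix.det_mul, Matrix.det_transpose, Real.sqrt_mul_self_eq_abs, hN, Matrix.det_mul,
      Matrix.det_fromBlocks_zero₂₁, abs_mul, abs_mul, hPQ]

end


/-! ### Densities on manifolds -/

/-- Measures that agree on the overlaps of their carriers `S j` glue to one measure. It dominates
each of them, and is built from their restrictions, so it is their supremum. Its mass can therefore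
be read off any countable measurable partition subordinate to the carriers. -/
theorem iSup_measure_univ {Y J : Type*} [MeasurableSpace Y] (m : J → Measure Y) (S : J → Set Y)
    (𝒜 : Set J) (hS : ∀ j ∈ 𝒜, MeasurableSet (S j)) (h0 : ∀ j ∈ 𝒜, m j (S j)ᶜ = 0)
    (hm : ∀ j ∈ 𝒜, ∀ k ∈ 𝒜, ∀ B, MeasurableSet B → B ⊆ S j → B ⊆ S k → m j B = m k B)
    (V : ℕ → Set Y) (j : ℕ → J) (hj : ∀ n, j n ∈ 𝒜) (hV : ∀ n, MeasurableSet (V n))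
    (hd : Pairwise (Function.onFun Disjoint V)) (hVS : ∀ n, V n ⊆ S (j n)) (hu : ⋃ n, V n = univ) :
    (⨆ φ ∈ 𝒜, m φ) univ = ∑' n, m (j n) (V n) := by
  set μ : Measure Y := Measure.sum fun n => (m (j n)).restrict (V n) with hμ
  have hsplit : ∀ (ν : Measure Y) (B : Set Y), MeasurableSet B → ν B = ∑' n, ν (B ∩ V n) := by
    intro ν B hB
    rw [← measure_iUnion (fun a b hab => (hd hab).mono inter_subset_right inter_subset_right)
      (fun n => hB.inter (hV n)), ← inter_iUnion, hu, inter_univ]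
  have hμB : ∀ B, MeasurableSet B → μ B = ∑' n, m (j n) (B ∩ V n) := by
    intro B hB
    rw [hμ, Measure.sum_apply _ hB]
    exact tsum_congr fun n => Measure.restrict_apply hB
  have : (⨆ φ ∈ 𝒜, m φ) = μ := by
    apply le_antisymm
    · refine iSup₂_le fun φ hφ => Measure.le_iff.mpr fun B hB => ?_
      have h1 : m φ B = m φ (B ∩ S φ) := by
        rw [← measure_inter_add_sdiff B (hS φ hφ),
          measure_mono_null (show B \ S φ ⊆ (S φ)ᶜ from fun x hx => hx.2) (h0 φ hφ), add_zero]
      rw [h1, hsplit _ _ (hB.inter (hS φ hφ)), hμB B hB]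
      refine ENNReal.tsum_le_tsum fun n => ?_
      rw [hm φ hφ (j n) (hj n) _ ((hB.inter (hS φ hφ)).inter (hV n)) (fun x hx => hx.1.2)
        (fun x hx => hVS n hx.2)]
      exact measure_mono fun x hx => ⟨hx.1.1, hx.2⟩
    · refine Measure.le_iff.mpr fun B hB => ?_
      rw [hμB B hB, hsplit _ B hB]
      exact ENNReal.tsum_le_tsum fun n =>
        Measure.le_iff.mp (le_iSup₂ (f := fun φ (_ : φ ∈ 𝒜) => m φ) (j n) (hj n)) _
          (hB.inter (hV n))
  rw [this, hμB _ MeasurableSet.univ]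
  simp

section Charts

variable {E H M : Type*} [NormedAddCommGroup E] [NormedSpace ℝ E] [TopologicalSpace H]
  [TopologicalSpace M] [ChartedSpace H M] (I : ModelWithCorners ℝ E H)

/-- The derivative of the inverse of a chart, as an endomorphism of the model space. -/
noncomputable def symmDeriv (φ : OpenPartialHomeomorph M H) (u : E) : E →L[ℝ] E :=
  mfderiv 𝓘(ℝ, E) I (φ.extend I).symm u

variable [IsManifold I 1 M]

theorem mdifferentiableAt_extend {φ : OpenPartialHomeomorph M H} (hφ : φ ∈ atlas H M) {x : M}
    (hx : x ∈ φ.source) : MDifferentiableAt I 𝓘(ℝ, E) (φ.extend I) x :=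
  ((OpenPartialHomeomorph.contMDiffOn_extend (I := I) (n := 1)
    (IsManifold.subset_maximalAtlas hφ)).contMDiffAt
      (φ.open_source.mem_nhds hx)).mdifferentiableAt one_ne_zero

variable [I.Boundaryless]

theorem mdifferentiableAt_extend_symm {φ : OpenPartialHomeomorph M H} (hφ : φ ∈ atlas H M) {u : E}
    (hu : u ∈ (φ.extend I).target) : MDifferentiableAt 𝓘(ℝ, E) I (φ.extend I).symm u := by
  have h := contMDiffOn_extend_symm (I := I) (n := 1) (IsManifold.subset_maximalAtlas hφ)
  rw [← φ.extend_target'] at h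
  exact (h.contMDiffAt ((φ.isOpen_extend_target (I := I)).mem_nhds hu)).mdifferentiableAt one_ne_zero

theorem mfderiv_extend_symm_eq {φ ψ : OpenPartialHomeomorph M H} (hφ : φ ∈ atlas H M)
    (hψ : ψ ∈ atlas H M) {u : E} (hu : u ∈ (φ.extend I).target)
    (huψ : (φ.extend I).symm u ∈ ψ.source) :
    DifferentiableAt ℝ (ψ.extend I ∘ (φ.extend I).symm) u ∧
    symmDeriv I φ u = symmDeriv I ψ ((ψ.extend I) ((φ.extend I).symm u))
      ∘L fderiv ℝ (ψ.extend I ∘ (φ.extend I).symm) u := by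
  have h1 : MDifferentiableAt 𝓘(ℝ, E) 𝓘(ℝ, E) (ψ.extend I ∘ (φ.extend I).symm) u :=
    (mdifferentiableAt_extend I hψ huψ).comp u (mdifferentiableAt_extend_symm I hφ hu)
  refine ⟨h1.differentiableAt, ?_⟩
  have hev : (φ.extend I).symm =ᶠ[nhds u]
      (ψ.extend I).symm ∘ (ψ.extend I ∘ (φ.extend I).symm) := by
    have hcont : ContinuousAt (φ.extend I).symm u :=
      (mdifferentiableAt_extend_symm I hφ hu).continuousAt
    filter_upwards [hcont (ψ.open_source.mem_nhds huψ)] with y hy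
    exact (ψ.extend_left_inv hy).symm
  have hmem : (ψ.extend I ∘ (φ.extend I).symm) u ∈ (ψ.extend I).target :=
    (ψ.extend I).map_source (by rwa [ψ.extend_source])
  have h2 : symmDeriv I φ u = symmDeriv I ψ ((ψ.extend I) ((φ.extend I).symm u))
      ∘L (mfderiv 𝓘(ℝ, E) 𝓘(ℝ, E) (ψ.extend I ∘ (φ.extend I).symm) u : E →L[ℝ] E) :=
    hev.mfderiv_eq.trans (mfderiv_comp u (mdifferentiableAt_extend_symm I hψ hmem) h1)
  rw [h2]
  exact congrArg _ mfderiv_eq_fderiv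

end Charts

section Density

variable {E H M κ : Type*} [NormedAddCommGroup E] [NormedSpace ℝ E] [MeasurableSpace E]
  [BorelSpace E] [TopologicalSpace H] [TopologicalSpace M] [ChartedSpace H M] [MeasurableSpace M]
  [Fintype κ] (I : ModelWithCorners ℝ E H) (b : Module.Basis κ ℝ E) (U : Set M)
  (ρ : ∀ x : M, (κ → TangentSpace I x) → ℝ)

/-- The coordinate expression of a density. -/
noncomputable def chartDensity (φ : OpenPartialHomeomorph M H) (u : E) : ℝ≥0∞ :=
  ENNReal.ofReal
    (ρ ((φ.extend I).symm u) (fun k => mfderiv 𝓘(ℝ, E) I (φ.extend I).symm u (b k)))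

/-- The measure defined by a density on the domain of a chart. -/
noncomputable def chartMeasure (φ : OpenPartialHomeomorph M H) : Measure M :=
  ((b.addHaar.restrict ((φ.extend I).target ∩ (φ.extend I).symm ⁻¹' U)).withDensity
    (chartDensity I b ρ φ)).map (φ.extend I).symm

/-- The transformation rule of a density. -/
def IsDensity [DecidableEq κ] : Prop :=
  ∀ (x : M) (v : κ → TangentSpace I x) (N : Matrix κ κ ℝ),
    ρ x (fun k => ∑ l, N l k • v l) = |N.det| * ρ x v

variable [BorelSpace M] [I.Boundaryless]

theorem measurableSet_target_inter_preimage (φ : OpenPartialHomeomorph M H) {B : Set M}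
    (hB : MeasurableSet B) :
    MeasurableSet ((φ.extend I).target ∩ (φ.extend I).symm ⁻¹' B) := by
  have ht : MeasurableSet (φ.extend I).target := (φ.isOpen_extend_target (I := I)).measurableSet
  have hc := (φ.continuousOn_extend_symm (I := I)).domRestrict.measurable hB
  have := ht.subtype_image hc
  rwa [show Subtype.val '' ((φ.extend I).target.domRestrict (φ.extend I).symm ⁻¹' B)
    = (φ.extend I).target ∩ (φ.extend I).symm ⁻¹' B from by ext x; simp [and_comm]] at this

theorem chartMeasure_apply {U : Set M} (hU : MeasurableSet U) (φ : OpenPartialHomeomorph M H)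
    {B : Set M} (hB : MeasurableSet B) :
    chartMeasure I b U ρ φ B
      = ∫⁻ u in (φ.extend I).target ∩ (φ.extend I).symm ⁻¹' (U ∩ B),
        chartDensity I b ρ φ u ∂b.addHaar := by
  have ht : MeasurableSet (φ.extend I).target := (φ.isOpen_extend_target (I := I)).measurableSet
  -- `Measure.map` is zero by default for a map that is not a.e. measurable. Outside the target
  -- nothing is known about the inverse chart, but continuity on the open target is enough after
  -- restriction.
  have hae : AEMeasurable (φ.extend I).symm
      (b.addHaar.restrict ((φ.extend I).target ∩ (φ.extend I).symm ⁻¹' U)) :=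
    ((φ.continuousOn_extend_symm (I := I)).aemeasurable ht).mono_measure
      (Measure.restrict_mono inter_subset_left le_rfl)
  rw [chartMeasure, Measure.map_apply_of_aemeasurable
    (hae.mono_ac (withDensity_absolutelyContinuous _ _)) hB, withDensity_apply' _ _,
    Measure.restrict_restrict' (measurableSet_target_inter_preimage I φ hU)]
  congr 2
  ext x
  simp only [mem_inter_iff, mem_preimage]
  tauto

theorem chartMeasure_compl_source {U : Set M} (hU : MeasurableSet U)
    (φ : OpenPartialHomeomorph M H) : chartMeasure I b U ρ φ φ.sourceᶜ = 0 := by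
  rw [chartMeasure_apply I b ρ hU φ φ.open_source.measurableSet.compl]
  have : (φ.extend I).target ∩ (φ.extend I).symm ⁻¹' (U ∩ φ.sourceᶜ) = ∅ := by
    ext x
    simp only [mem_inter_iff, mem_preimage, mem_compl_iff, mem_empty_iff_false, iff_false, not_and,
      not_not]
    intro hx _
    have := (φ.extend I).map_target hx
    rwa [φ.extend_source] at this
  rw [this]
  simp

variable [IsManifold I 1 M]

theorem chartDensity_eq [DecidableEq κ] (hρ : IsDensity I ρ) {φ ψ : OpenPartialHomeomorph M H}
    (hφ : φ ∈ atlas H M) (hψ : ψ ∈ atlas H M) {u : E} (hu : u ∈ (φ.extend I).target)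
    (huψ : (φ.extend I).symm u ∈ ψ.source) :
    chartDensity I b ρ φ u
      = ENNReal.ofReal |(fderiv ℝ (ψ.extend I ∘ (φ.extend I).symm) u).det|
        * chartDensity I b ρ ψ ((ψ.extend I ∘ (φ.extend I).symm) u) := by
  have h := (mfderiv_extend_symm_eq I hφ hψ hu huψ).2
  have hx : (ψ.extend I).symm (ψ.extend I ((φ.extend I).symm u)) = (φ.extend I).symm u :=
    ψ.extend_left_inv huψ
  set D := fderiv ℝ (ψ.extend I ∘ (φ.extend I).symm) u with hD
  set r : M → (κ → E) → ℝ := ρ with hr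
  have e1 : chartDensity I b ρ φ u = ENNReal.ofReal (r ((φ.extend I).symm u)
    (fun k => symmDeriv I φ u (b k))) := rfl
  have e2 : chartDensity I b ρ ψ ((ψ.extend I ∘ (φ.extend I).symm) u)
    = ENNReal.ofReal (r ((ψ.extend I).symm (ψ.extend I ((φ.extend I).symm u)))
    (fun k => symmDeriv I ψ (ψ.extend I ((φ.extend I).symm u)) (b k))) := rfl
  rw [e1, e2, hx, h, ← ENNReal.ofReal_mul (abs_nonneg _)]
  set P : E →L[ℝ] E := symmDeriv I ψ (ψ.extend I ((φ.extend I).symm u))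
  have hk : ∀ k, (P ∘L D) (b k) = ∑ l, LinearMap.toMatrix b b D.toLinearMap l k • P (b l) := by
    intro k
    rw [ContinuousLinearMap.comp_apply, ← b.sum_repr (D (b k)), map_sum]
    simp [LinearMap.toMatrix_apply]
  simp_rw [hk]
  rw [show r ((φ.extend I).symm u) (fun k => ∑ l, LinearMap.toMatrix b b D.toLinearMap l k • P (b l))
    = |(LinearMap.toMatrix b b D.toLinearMap).det| * r ((φ.extend I).symm u) (fun k => P (b k)) from
    hρ _ _ _, LinearMap.det_toMatrix]

/-- Change of variables along the transition map, whose Jacobian is absorbed by the transformation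
rule of a density. The formula used holds for arbitrary integrands, so `ρ` need not be measurable.
-/
theorem chartMeasure_eq [DecidableEq κ] (hρ : IsDensity I ρ) {U : Set M} (hU : MeasurableSet U)
    {φ ψ : OpenPartialHomeomorph M H} (hφ : φ ∈ atlas H M) (hψ : ψ ∈ atlas H M) {B : Set M}
    (hB : MeasurableSet B) (hBφ : B ⊆ φ.source) (hBψ : B ⊆ ψ.source) :
    chartMeasure I b U ρ φ B = chartMeasure I b U ρ ψ B := by
  have : FiniteDimensional ℝ E := b.finiteDimensional_of_finite
  rw [chartMeasure_apply I b ρ hU φ hB, chartMeasure_apply I b ρ hU ψ hB]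
  have hUB : MeasurableSet (U ∩ B) := hU.inter hB
  set s := (φ.extend I).target ∩ (φ.extend I).symm ⁻¹' (U ∩ B) with hs
  have hsm : MeasurableSet s := measurableSet_target_inter_preimage I φ hUB
  set h := ψ.extend I ∘ (φ.extend I).symm with hh
  have himg : (ψ.extend I).target ∩ (ψ.extend I).symm ⁻¹' (U ∩ B) = h '' s := by
    ext y
    constructor
    · rintro ⟨hy, hyU⟩
      have hyφ : (ψ.extend I).symm y ∈ (φ.extend I).source := by
        rw [φ.extend_source]; exact hBφ hyU.2
      refine ⟨φ.extend I ((ψ.extend I).symm y), ⟨(φ.extend I).map_source hyφ, ?_⟩, ?_⟩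
      · rw [mem_preimage, (φ.extend I).left_inv hyφ]
        exact hyU
      · rw [hh, Function.comp_apply, (φ.extend I).left_inv hyφ, (ψ.extend I).right_inv hy]
    · rintro ⟨u, ⟨hu, huU⟩, rfl⟩
      have hψs : (φ.extend I).symm u ∈ (ψ.extend I).source := by
        rw [ψ.extend_source]; exact hBψ huU.2
      refine ⟨(ψ.extend I).map_source hψs, ?_⟩
      rw [mem_preimage, hh, Function.comp_apply, (ψ.extend I).left_inv hψs]
      exact huU
  have hinj : InjOn h s := by
    intro u hu v hv huv
    have h1 : (φ.extend I).symm u ∈ (ψ.extend I).source := by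
      rw [ψ.extend_source]; exact hBψ hu.2.2
    have h2 : (φ.extend I).symm v ∈ (ψ.extend I).source := by
      rw [ψ.extend_source]; exact hBψ hv.2.2
    exact (φ.extend I).symm.injOn hu.1 hv.1 ((ψ.extend I).injOn h1 h2 huv)
  rw [himg, lintegral_image_eq_lintegral_abs_det_fderiv_mul _ hsm
    (fun u hu => (mfderiv_extend_symm_eq I hφ hψ hu.1 (hBψ hu.2.2)).1.hasFDerivAt.hasFDerivWithinAt)
    hinj]
  exact setLIntegral_congr_fun hsm fun u hu => chartDensity_eq I b ρ hρ hφ hψ hu.1 (hBψ hu.2.2)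

theorem densityIntegral_eq_tsum [DecidableEq κ] (hρ : IsDensity I ρ) {U : Set M}
    (hU : MeasurableSet U) (V : ℕ → Set M) (φ : ℕ → OpenPartialHomeomorph M H)
    (hφ : ∀ n, φ n ∈ atlas H M) (hV : ∀ n, MeasurableSet (V n))
    (hd : Pairwise (Function.onFun Disjoint V)) (hVφ : ∀ n, V n ⊆ (φ n).source)
    (hu : ⋃ n, V n = univ) :
    densityIntegral I b U ρ = ∑' n, ∫⁻ u in ((φ n).extend I).target ∩
      ((φ n).extend I).symm ⁻¹' (U ∩ V n), chartDensity I b ρ (φ n) u ∂b.addHaar := by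
  have h := iSup_measure_univ (chartMeasure I b U ρ) (fun φ => φ.source) (atlas H M)
    (fun φ _ => φ.open_source.measurableSet) (fun φ _ => chartMeasure_compl_source I b ρ hU φ)
    (fun φ hφ ψ hψ B hB h1 h2 => chartMeasure_eq I b ρ hρ hU hφ hψ hB h1 h2)
    V φ hφ hV hd hVφ hu
  simp_rw [chartMeasure_apply I b ρ hU _ (hV _)] at h
  exact h

end Density


/-! ### Covariance of the curvature -/

/-- Naturality `d(h^*α) = h^*(dα)`: the terms with the second derivative of `h` cancel by symmetry.
-/
theorem fderiv_pullback_sub {E F : Type*} [NormedAddCommGroup E] [NormedSpace ℝ E]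
    [NormedAddCommGroup F] [NormedSpace ℝ F] {α : E → E →L[ℝ] F} {h : E → E} {u : E}
    (hα : DifferentiableAt ℝ α (h u)) (hh : ContDiffAt ℝ 2 h u) (v w : E) :
    fderiv ℝ (fun y => (α (h y)).comp (fderiv ℝ h y)) u v w
        - fderiv ℝ (fun y => (α (h y)).comp (fderiv ℝ h y)) u w v
      = fderiv ℝ α (h u) (fderiv ℝ h u v) (fderiv ℝ h u w)
        - fderiv ℝ α (h u) (fderiv ℝ h u w) (fderiv ℝ h u v) := by
  have h1 : HasFDerivAt h (fderiv ℝ h u) u :=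
    (hh.differentiableAt (by norm_num)).hasFDerivAt
  have h2 : HasFDerivAt (fderiv ℝ h) (fderiv ℝ (fderiv ℝ h) u) u :=
    ((hh.fderiv_right (m := 1) (by norm_num)).differentiableAt one_ne_zero).hasFDerivAt
  have h3 := (hα.hasFDerivAt.comp u h1).clm_comp h2
  have h4 : fderiv ℝ (fun y => (α (h y)).comp (fderiv ℝ h y)) u = _ := h3.fderiv
  have hsymm : IsSymmSndFDerivAt ℝ h u := hh.isSymmSndFDerivAt (by simp)
  rw [h4]
  simp [hsymm v w]

set_option synthInstance.maxHeartbeats 200000 in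
set_option maxHeartbeats 800000 in
-- Differentiate the gauge identity once more and antisymmetrise in `v, w`. The second derivatives
-- of `O` cancel; substituting the identity for the first derivatives and applying the Jacobi
-- identity leaves `(F' - O F) × O z = 0` for all `z`, and a vector whose cross products all vanish
-- is zero.
theorem gauge_transformation_curvature {E : Type*} [NormedAddCommGroup E] [NormedSpace ℝ E]
    {O : E → R3 →L[ℝ] R3} {α α' : E → E →L[ℝ] R3} {u : E} (hO : ContDiffAt ℝ 2 O u)
    (hα : DifferentiableAt ℝ α u) (hα' : DifferentiableAt ℝ α' u)
    (hcross : ∀ a b, O u (a ⨯₃ b) = O u a ⨯₃ O u b) (hsurj : Function.Surjective (O u))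
    (h : ∀ᶠ y in nhds u, ∀ v z, fderiv ℝ O y v z + α' y v ⨯₃ O y z = O y (α y v ⨯₃ z)) (v w : E) :
    fderiv ℝ α' u v w - fderiv ℝ α' u w v + α' u v ⨯₃ α' u w
      = O u (fderiv ℝ α u v w - fderiv ℝ α u w v + α u v ⨯₃ α u w) := by
  set C : R3 →L[ℝ] R3 →L[ℝ] R3 := (crossProduct (R := ℝ)).toContinuousBilinearMap with hC
  have hCapp : ∀ a b, C a b = a ⨯₃ b := fun a b => rfl
  have hD : HasFDerivAt O (fderiv ℝ O u) u := (hO.differentiableAt (by norm_num)).hasFDerivAt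
  have hD2 : HasFDerivAt (fderiv ℝ O) (fderiv ℝ (fderiv ℝ O) u) u :=
    ((hO.fderiv_right (m := 1) (by norm_num)).differentiableAt one_ne_zero).hasFDerivAt
  have hsymm : IsSymmSndFDerivAt ℝ O u := hO.isSymmSndFDerivAt (by simp)
  -- The derivative in the direction `v` of the gauge identity evaluated on `w` and `z`.
  have key : ∀ v w z, fderiv ℝ (fderiv ℝ O) u v w z
      + (fderiv ℝ α' u v w ⨯₃ O u z + α' u w ⨯₃ fderiv ℝ O u v z)
      = fderiv ℝ O u v (α u w ⨯₃ z) + O u (fderiv ℝ α u v w ⨯₃ z) := by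
    intro v w z
    have l1 := (hD2.clm_apply (hasFDerivAt_const w u)).clm_apply (hasFDerivAt_const z u)
    have l2 := (C.hasFDerivAt.comp u (hα'.hasFDerivAt.clm_apply (hasFDerivAt_const w u))).clm_apply
      (hD.clm_apply (hasFDerivAt_const z u))
    have l3 := hD.clm_apply ((C.hasFDerivAt.comp u
      (hα.hasFDerivAt.clm_apply (hasFDerivAt_const w u))).clm_apply (hasFDerivAt_const z u))
    have e : (fun y => fderiv ℝ O y w z + C (α' y w) (O y z)) =ᶠ[nhds u]
        fun y => O y (C (α y w) z) := by
      filter_upwards [h] with y hy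
      exact hy w z
    have e2 := congrArg (fun N => N v) (((l1.add l2).congr_of_eventuallyEq e.symm).unique l3)
    simpa [hCapp, add_comm] using e2
  have h0 : ∀ v z, fderiv ℝ O u v z = O u (α u v ⨯₃ z) - α' u v ⨯₃ O u z :=
    fun v z => eq_sub_of_add_eq (h.self_of_nhds v z)
  have main : ∀ z, (fderiv ℝ α' u v w - fderiv ℝ α' u w v + α' u v ⨯₃ α' u w
      - O u (fderiv ℝ α u v w - fderiv ℝ α u w v + α u v ⨯₃ α u w)) ⨯₃ O u z = 0 := by
    intro z
    have k1 := key v w z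
    have k2 := key w v z
    rw [hsymm w v] at k2
    simp only [h0, hcross, map_sub, map_add, LinearMap.sub_apply, LinearMap.add_apply,
      cross_cross] at k1 k2 ⊢
    have k3 := congrArg₂ (· - ·) k1 k2
    beta_reduce at k3
    rw [← sub_eq_zero] at k3
    refine Eq.trans ?_ k3
    abel
  have main' : ∀ z, (fderiv ℝ α' u v w - fderiv ℝ α' u w v + α' u v ⨯₃ α' u w
      - O u (fderiv ℝ α u v w - fderiv ℝ α u w v + α u v ⨯₃ α u w)) ⨯₃ z = 0 := fun z => by
    obtain ⟨z, rfl⟩ := hsurj z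
    exact main z
  rw [← sub_eq_zero]
  set q := fderiv ℝ α' u v w - fderiv ℝ α' u w v + α' u v ⨯₃ α' u w
      - O u (fderiv ℝ α u v w - fderiv ℝ α u w v + α u v ⨯₃ α u w)
  have q0 := main' (Pi.single 0 1)
  have q1 := main' (Pi.single 1 1)
  ext i
  fin_cases i
  · have := congrFun q1 2
    simpa [crossProduct] using this
  · have := congrFun q0 2
    simpa [crossProduct] using this
  · have := congrFun q0 1
    simpa [crossProduct] using this

/-- For every 3 by 3 matrix, `Nᵀ(Na × Nb) = det N (a × b)`; orthogonality and unit determinant then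
give the claim. -/
theorem specialOrthogonal_cross {N : Matrix (Fin 3) (Fin 3) ℝ}
    (hN : N ∈ Matrix.specialOrthogonalGroup (Fin 3) ℝ) (a b : R3) :
    N *ᵥ (a ⨯₃ b) = (N *ᵥ a) ⨯₃ (N *ᵥ b) := by
  obtain ⟨h1, h2⟩ := Matrix.mem_specialOrthogonalGroup_iff.mp hN
  have hNN : N * Nᵀ = 1 := (Matrix.mem_orthogonalGroup_iff (Fin 3) ℝ).mp h1
  have hN' : Nᵀ *ᵥ ((N *ᵥ a) ⨯₃ (N *ᵥ b)) = a ⨯₃ b := by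
    have hd : Nᵀ *ᵥ ((N *ᵥ a) ⨯₃ (N *ᵥ b)) = N.det • (a ⨯₃ b) := by
      ext i
      fin_cases i <;>
      · simp [Matrix.mulVec, dotProduct, Fin.sum_univ_three, crossProduct, Matrix.det_fin_three]
        ring
    rw [hd, h2, one_smul]
  rw [← hN', Matrix.mulVec_mulVec, hNN, Matrix.one_mulVec]


section

variable {E H M F : Type*} [NormedAddCommGroup E] [NormedSpace ℝ E] [TopologicalSpace H]
  [TopologicalSpace M] [ChartedSpace H M] (I : ModelWithCorners ℝ E H) [IsManifold I 1 M]
  [I.Boundaryless] [NormedAddCommGroup F] [NormedSpace ℝ F]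

theorem mvfderiv_symmDeriv {g : M → F} {c : OpenPartialHomeomorph M H} (hc : c ∈ atlas H M) {u : E}
    (hu : u ∈ (c.extend I).target) (hg : MDifferentiableAt I 𝓘(ℝ, F) g ((c.extend I).symm u))
    (p : E) :
    mvfderiv I g ((c.extend I).symm u) (symmDeriv I c u p)
      = fderiv ℝ (g ∘ (c.extend I).symm) u p := by
  have h := mfderiv_comp u hg (mdifferentiableAt_extend_symm I hc hu)
  rw [mfderiv_eq_fderiv] at h
  rw [h]
  rfl

/-- Coordinate vector fields are smooth, being images of constant fields under the tangent map of
the inverse chart. Pairing the connection form with them makes `localForm` smooth. -/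
theorem contMDiffOn_symmDeriv_section [IsManifold I ∞ M] {c : OpenPartialHomeomorph M H}
    (hc : c ∈ atlas H M) (p : E) :
    ContMDiffOn 𝓘(ℝ, E) I.tangent ∞ (fun u => TotalSpace.mk' E (E := TangentSpace I (M := M))
      ((c.extend I).symm u) (symmDeriv I c u p)) (c.extend I).target := by
  have hsymm : ContMDiffOn 𝓘(ℝ, E) I ∞ (c.extend I).symm (c.extend I).target := by
    have h := contMDiffOn_extend_symm (I := I) (n := ∞) (IsManifold.subset_maximalAtlas hc)
    rwa [← c.extend_target'] at h
  have hopen : IsOpen (c.extend I).target := c.isOpen_extend_target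
  have h1 := hsymm.contMDiffOn_tangentMapWithin (m := ∞) (by simp) hopen.uniqueMDiffOn
  have hconst : ContMDiff 𝓘(ℝ, E) 𝓘(ℝ, E).tangent ∞
      (fun u => (⟨u, p⟩ : TangentBundle 𝓘(ℝ, E) E)) := by
    intro u
    refine (Bundle.contMDiffAt_section (E := TangentSpace 𝓘(ℝ, E)) (s := fun _ => p) u).mpr ?_
    refine contMDiffAt_const (c := p) |>.congr_of_eventuallyEq (Filter.Eventually.of_forall ?_)
    intro y
    exact congrArg (fun N => N p) (TangentBundle.coordChange_model_space (𝕜 := ℝ) y u y)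
  have h2 := h1.comp (hconst.contMDiffOn (s := (c.extend I).target)) (fun u hu => hu)
  refine h2.congr fun u hu => ?_
  simp only [Function.comp_apply, tangentMapWithin]
  rw [mfderivWithin_of_isOpen hopen hu]
  rfl

end

section Connection

variable {M : Type*} [TopologicalSpace M] [ChartedSpace R4 M] {ι : Type*}
  [IsManifold (𝓡 4) ∞ M] {Z : VectorBundleCore ℝ M R3 ι} (A : SO3Connection Z)

/-- The connection 1-form of a trivialisation in the coordinates of a chart. -/
noncomputable def localForm (a : ι) (c : OpenPartialHomeomorph M R4) (u : R4) : R4 →L[ℝ] R3 :=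
  ContinuousLinearMap.comp (A.form a ((c.extend (𝓡 4)).symm u) : R4 →L[ℝ] R3)
    (symmDeriv (𝓡 4) c u)

/-- The curvature in the coordinates of a chart and a trivialisation. -/
noncomputable def localCurv (a : ι) (c : OpenPartialHomeomorph M R4) (u p q : R4) : R3 :=
  fderiv ℝ (localForm A a c) u p q - fderiv ℝ (localForm A a c) u q p
    + localForm A a c u p ⨯₃ localForm A a c u q

/-- The coordinate domain of a chart and a trivialisation. -/
def coordDomain (Z : VectorBundleCore ℝ M R3 ι) (a : ι) (c : OpenPartialHomeomorph M R4) : Set R4 :=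
  (c.extend (𝓡 4)).target ∩ (c.extend (𝓡 4)).symm ⁻¹' Z.baseSet a

theorem isOpen_coordDomain (a : ι) (c : OpenPartialHomeomorph M R4) :
    IsOpen (coordDomain Z a c) :=
  (c.continuousOn_extend_symm (I := 𝓡 4)).isOpen_inter_preimage c.isOpen_extend_target
    (Z.isOpen_baseSet a)

theorem contDiffOn_localForm (a : ι) {c : OpenPartialHomeomorph M R4} (hc : c ∈ atlas R4 M) :
    ContDiffOn ℝ ∞ (localForm A a c) (coordDomain Z a c) := by
  rw [contDiffOn_clm_apply]
  intro p
  have hsymm : ContMDiffOn 𝓘(ℝ, R4) (𝓡 4) ∞ (c.extend (𝓡 4)).symm (c.extend (𝓡 4)).target := by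
    have h := contMDiffOn_extend_symm (I := 𝓡 4) (n := ∞) (IsManifold.subset_maximalAtlas hc)
    rwa [← c.extend_target'] at h
  have h1 := (A.smooth a).comp (hsymm.mono inter_subset_left : ContMDiffOn _ _ _ _
    (coordDomain Z a c)) (fun u hu => hu.2)
  have h2 := (contMDiffOn_symmDeriv_section (𝓡 4) hc p).mono
    (inter_subset_left : coordDomain Z a c ⊆ _)
  have h3 := ContMDiffOn.clm_bundle_apply (E₁ := TangentSpace (𝓡 4) (M := M))
    (E₂ := Bundle.Trivial M R3) (b := (c.extend (𝓡 4)).symm) h1 h2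
  rw [← contMDiffOn_iff_contDiffOn]
  intro u hu
  have h4 := h3 u hu
  rw [Bundle.contMDiffWithinAt_totalSpace] at h4
  exact h4.2

theorem differentiableAt_localForm (a : ι) {c : OpenPartialHomeomorph M R4} (hc : c ∈ atlas R4 M)
    {u : R4} (hu : u ∈ coordDomain Z a c) : DifferentiableAt ℝ (localForm A a c) u :=
  ((contDiffOn_localForm A a hc).contDiffAt ((isOpen_coordDomain a c).mem_nhds hu)).differentiableAt
    (by simp)

theorem contDiffAt_transition {c ψ : OpenPartialHomeomorph M R4} (hc : c ∈ atlas R4 M)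
    (hψ : ψ ∈ atlas R4 M) {u : R4} (hu : u ∈ (c.extend (𝓡 4)).target)
    (huψ : (c.extend (𝓡 4)).symm u ∈ ψ.source) :
    ContDiffAt ℝ 2 (ψ.extend (𝓡 4) ∘ (c.extend (𝓡 4)).symm) u := by
  have hsymm : ContMDiffOn 𝓘(ℝ, R4) (𝓡 4) 2 (c.extend (𝓡 4)).symm (c.extend (𝓡 4)).target := by
    have h := contMDiffOn_extend_symm (I := 𝓡 4) (n := ∞) (IsManifold.subset_maximalAtlas hc)
    rw [← c.extend_target'] at h
    exact h.of_le ENat.LEInfty.out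
  have h2 : ContMDiffAt (𝓡 4) 𝓘(ℝ, R4) 2 (ψ.extend (𝓡 4)) ((c.extend (𝓡 4)).symm u) :=
    ((OpenPartialHomeomorph.contMDiffOn_extend (I := 𝓡 4) (n := ∞)
      (IsManifold.subset_maximalAtlas hψ)).contMDiffAt (ψ.open_source.mem_nhds huψ)).of_le ENat.LEInfty.out
  rw [← contMDiffAt_iff_contDiffAt]
  exact h2.comp u (hsymm.contMDiffAt (c.isOpen_extend_target.mem_nhds hu))

/-- `extDeriv1` differentiates in the preferred chart at each point, which jumps as the point moves.
By naturality of `d` it may be computed in one fixed chart. -/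
theorem extDeriv1_eq (a : ι) {c : OpenPartialHomeomorph M R4} (hc : c ∈ atlas R4 M)
    {u : R4} (hu : u ∈ coordDomain Z a c) (p q : R4) :
    extDeriv1 (A.form a) ((c.extend (𝓡 4)).symm u) (symmDeriv (𝓡 4) c u p) (symmDeriv (𝓡 4) c u q)
      = fderiv ℝ (localForm A a c) u p q - fderiv ℝ (localForm A a c) u q p := by
  set x := (c.extend (𝓡 4)).symm u with hx
  set ψ := chartAt R4 x with hψdef
  have hψ : ψ ∈ atlas R4 M := chart_mem_atlas _ _
  have hxψ : x ∈ ψ.source := mem_chart_source _ _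
  set h := ψ.extend (𝓡 4) ∘ (c.extend (𝓡 4)).symm with hh
  have hcd := contDiffAt_transition hc hψ hu.1 hxψ
  have hhu : h u = ψ.extend (𝓡 4) x := rfl
  have hhu' : h u ∈ coordDomain Z a ψ := by
    refine ⟨(ψ.extend (𝓡 4)).map_source (by rwa [ψ.extend_source]), ?_⟩
    rw [mem_preimage, hhu, ψ.extend_left_inv hxψ]
    exact hu.2
  have hev : localForm A a c =ᶠ[nhds u] fun y => (localForm A a ψ (h y)).comp (fderiv ℝ h y) := by
    have hcont : ContinuousAt (c.extend (𝓡 4)).symm u :=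
      (mdifferentiableAt_extend_symm (𝓡 4) hc hu.1).continuousAt
    filter_upwards [hcont (ψ.open_source.mem_nhds hxψ), c.isOpen_extend_target.mem_nhds hu.1]
      with y hy hyt
    have e1 := (mfderiv_extend_symm_eq (𝓡 4) hc hψ hyt hy).2
    have e2 : (ψ.extend (𝓡 4)).symm (h y) = (c.extend (𝓡 4)).symm y := ψ.extend_left_inv hy
    have e3 : ∀ x x' : M, x = x' → (A.form a x : R4 →L[ℝ] R3) = A.form a x' := by
      rintro x _ rfl
      rfl
    rw [localForm, localForm, e1, e3 _ _ e2]
    rfl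
  have hvec : ∀ p, mfderiv (𝓡 4) 𝓘(ℝ, R4) (extChartAt (𝓡 4) x) x (symmDeriv (𝓡 4) c u p)
      = fderiv ℝ h u p := fun p =>
    mvfderiv_symmDeriv (𝓡 4) hc hu.1 (mdifferentiableAt_extend (𝓡 4) hψ hxψ) p
  rw [hev.fderiv_eq, fderiv_pullback_sub (differentiableAt_localForm A a hψ hhu') hcd]
  rw [← hvec p, ← hvec q]
  rfl

theorem curvature_symmDeriv (a : ι) {c : OpenPartialHomeomorph M R4} (hc : c ∈ atlas R4 M)
    {u : R4} (hu : u ∈ coordDomain Z a c) (p q : R4) :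
    A.curvature a ((c.extend (𝓡 4)).symm u) (symmDeriv (𝓡 4) c u p) (symmDeriv (𝓡 4) c u q)
      = localCurv A a c u p q := by
  exact congrArg (· + _) (extDeriv1_eq A a hc hu p q)

theorem coordChange_cross (hZ : IsSO3 Z) {i j : ι} {x : M} (hx : x ∈ Z.baseSet i ∩ Z.baseSet j)
    (a b : R3) :
    Z.coordChange i j x (a ⨯₃ b) = Z.coordChange i j x a ⨯₃ Z.coordChange i j x b := by
  have h := specialOrthogonal_cross (hZ i j x hx) a b
  simpa [LinearMap.toMatrix'_mulVec] using h

variable [Z.IsContMDiff (𝓡 4) ∞]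

theorem localCurv_coordChange (hZ : IsSO3 Z) (i j : ι) {c : OpenPartialHomeomorph M R4}
    (hc : c ∈ atlas R4 M) {u : R4} (hi : u ∈ coordDomain Z i c) (hj : u ∈ coordDomain Z j c)
    (p q : R4) :
    localCurv A j c u p q
      = Z.coordChange i j ((c.extend (𝓡 4)).symm u) (localCurv A i c u p q) := by
  have hopen : IsOpen (Z.baseSet i ∩ Z.baseSet j) := (Z.isOpen_baseSet i).inter (Z.isOpen_baseSet j)
  have hcc : ∀ y ∈ coordDomain Z i c ∩ coordDomain Z j c,
      ContMDiffAt (𝓡 4) 𝓘(ℝ, R3 →L[ℝ] R3) ∞ (Z.coordChange i j) ((c.extend (𝓡 4)).symm y) :=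
    fun y hy => (Z.contMDiffOn_coordChange (𝓡 4) (n := ∞) i j).contMDiffAt
      (hopen.mem_nhds ⟨hy.1.2, hy.2.2⟩)
  have hsymm : ContMDiffAt 𝓘(ℝ, R4) (𝓡 4) ∞ (c.extend (𝓡 4)).symm u := by
    have h := contMDiffOn_extend_symm (I := 𝓡 4) (n := ∞) (IsManifold.subset_maximalAtlas hc)
    rw [← c.extend_target'] at h
    exact h.contMDiffAt (c.isOpen_extend_target.mem_nhds hi.1)
  have hO : ContDiffAt ℝ 2 (Z.coordChange i j ∘ (c.extend (𝓡 4)).symm) u := by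
    rw [← contMDiffAt_iff_contDiffAt]
    exact ((hcc u ⟨hi, hj⟩).comp u hsymm).of_le ENat.LEInfty.out
  refine gauge_transformation_curvature (O := Z.coordChange i j ∘ (c.extend (𝓡 4)).symm) hO
    (differentiableAt_localForm A i hc hi) (differentiableAt_localForm A j hc hj)
    (fun a b => coordChange_cross hZ ⟨hi.2, hj.2⟩ a b) ?_ ?_ p q
  · intro z
    refine ⟨Z.coordChange j i ((c.extend (𝓡 4)).symm u) z, ?_⟩
    rw [Function.comp_apply, Z.coordChange_comp _ _ _ _ ⟨⟨hj.2, hi.2⟩, hj.2⟩,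
      Z.coordChange_self _ _ hj.2]
  · filter_upwards [((isOpen_coordDomain i c).inter (isOpen_coordDomain j c)).mem_nhds
      (⟨hi, hj⟩ : u ∈ coordDomain Z i c ∩ coordDomain Z j c)] with y hy v z
    have hg := A.gauge i j ((c.extend (𝓡 4)).symm y) ⟨hy.1.2, hy.2.2⟩ (symmDeriv (𝓡 4) c y v) z
    have hmd : MDifferentiableAt (𝓡 4) 𝓘(ℝ, R3 →L[ℝ] R3) (Z.coordChange i j)
        ((c.extend (𝓡 4)).symm y) := (hcc y hy).mdifferentiableAt (by simp)
    have hmd2 : MDifferentiableAt (𝓡 4) 𝓘(ℝ, R3) (fun x' => Z.coordChange i j x' z)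
        ((c.extend (𝓡 4)).symm y) := hmd.clm_apply mdifferentiableAt_const
    rw [mvfderiv_symmDeriv (𝓡 4) hc hy.1.1 hmd2] at hg
    have hOd : DifferentiableAt ℝ (Z.coordChange i j ∘ (c.extend (𝓡 4)).symm) y :=
      (hmd.comp y (mdifferentiableAt_extend_symm (𝓡 4) hc hy.1.1)).differentiableAt
    have e : fderiv ℝ ((fun x' => Z.coordChange i j x' z) ∘ (c.extend (𝓡 4)).symm) y v
        = fderiv ℝ (Z.coordChange i j ∘ (c.extend (𝓡 4)).symm) y v z := by
      have := hOd.hasFDerivAt.clm_apply (hasFDerivAt_const z y)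
      have h2 := this.fderiv
      have h3 := congrArg (fun N => N v) h2
      simp only [_root_.add_apply, ContinuousLinearMap.flip_apply,
        ContinuousLinearMap.comp_apply, _root_.zero_apply, map_zero, zero_add] at h3
      exact h3
    rw [e] at hg
    exact hg

end Connection


/-! ### The total space of the bundle -/

section Connection

variable {M : Type*} [TopologicalSpace M] [ChartedSpace R4 M] {ι : Type*}

/-- The coordinate frame as a basis. -/
noncomputable def frameBasis (x : M) : Module.Basis (Fin 4) ℝ (TangentSpace (𝓡 4) x) := stdBasis4

section Bundle

variable {Z : VectorBundleCore ℝ M R3 ι}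

theorem localTriv_coordChange (i j : ι) {p : TotalSpace R3 Z.Fiber}
    (hp : p.proj ∈ Z.baseSet i ∩ Z.baseSet j) :
    (Z.localTriv j p).2 = Z.coordChange i j p.proj (Z.localTriv i p).2 :=
  (Z.coordChange_comp _ _ _ _ ⟨⟨Z.mem_baseSet_at _, hp.1⟩, hp.2⟩ _).symm

theorem det_coordChange (hZ : IsSO3 Z) {i j : ι} {x : M} (hx : x ∈ Z.baseSet i ∩ Z.baseSet j) :
    (LinearMap.toMatrix' (Z.coordChange i j x : R3 →ₗ[ℝ] R3)).det = 1 :=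
  (Matrix.mem_specialOrthogonalGroup_iff.mp (hZ i j x hx)).2

theorem coordChange_dotProduct (hZ : IsSO3 Z) {i j : ι} {x : M}
    (hx : x ∈ Z.baseSet i ∩ Z.baseSet j) (a b : R3) :
    Z.coordChange i j x a ⬝ᵥ Z.coordChange i j x b = a ⬝ᵥ b := by
  set N := LinearMap.toMatrix' (Z.coordChange i j x : R3 →ₗ[ℝ] R3) with hN
  have h1 := (Matrix.mem_specialOrthogonalGroup_iff.mp (hZ i j x hx)).1
  have hNN : Nᵀ * N = 1 := (Matrix.mem_orthogonalGroup_iff' (Fin 3) ℝ).mp h1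
  have hv : ∀ v, Z.coordChange i j x v = N *ᵥ v := fun v => by
    rw [hN, LinearMap.toMatrix'_mulVec]; rfl
  rw [hv, hv, Matrix.dotProduct_mulVec, ← Matrix.mulVec_transpose, Matrix.mulVec_mulVec, hNN,
    Matrix.one_mulVec]

theorem ySq_eq (hZ : IsSO3 Z) (i : ι) {p : TotalSpace R3 Z.Fiber} (hp : p.proj ∈ Z.baseSet i) :
    ySq Z p = (Z.localTriv i p).2 ⬝ᵥ (Z.localTriv i p).2 := by
  rw [ySq, localTriv_coordChange i (Z.indexAt p.proj) ⟨hp, Z.mem_baseSet_at _⟩,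
    coordChange_dotProduct hZ ⟨hp, Z.mem_baseSet_at _⟩]

variable (p₀ : TotalSpace R3 Z.Fiber)

theorem totalChart_target :
    ((chartAt (ModelProd R4 R3) p₀).extend I7).target
      = coordDomain Z (Z.indexAt p₀.proj) (chartAt R4 p₀.proj) ×ˢ univ :=
  FiberBundle.extChartAt_target (IB := 𝓡 4) p₀

theorem totalChart_symm_apply {z : R4 × R3}
    (hz : z ∈ ((chartAt (ModelProd R4 R3) p₀).extend I7).target) :
    Z.localTriv (Z.indexAt p₀.proj) (((chartAt (ModelProd R4 R3) p₀).extend I7).symm z)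
      = (((chartAt R4 p₀.proj).extend (𝓡 4)).symm z.1, z.2) := by
  have h : (chartAt (ModelProd R4 R3) p₀).extend I7 = _ := FiberBundle.extChartAt (IB := 𝓡 4) p₀
  rw [totalChart_target] at hz
  rw [h]
  refine (Z.localTriv (Z.indexAt p₀.proj)).right_inv ?_
  exact ((Z.localTriv (Z.indexAt p₀.proj)).mem_target).mpr hz.1.2

theorem totalChart_symm_proj {z : R4 × R3}
    (hz : z ∈ ((chartAt (ModelProd R4 R3) p₀).extend I7).target) :
    (((chartAt (ModelProd R4 R3) p₀).extend I7).symm z).proj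
      = ((chartAt R4 p₀.proj).extend (𝓡 4)).symm z.1 :=
  congrArg Prod.fst (totalChart_symm_apply p₀ hz)

theorem totalChart_source :
    (chartAt (ModelProd R4 R3) p₀).source
      = π R3 Z.Fiber ⁻¹' ((chartAt R4 p₀.proj).source ∩ Z.baseSet (Z.indexAt p₀.proj)) := by
  rw [FiberBundle.chartedSpace_chartAt]
  ext q
  simp only [mfld_simps]
  exact and_comm


variable [IsManifold (𝓡 4) ∞ M] [Z.IsContMDiff (𝓡 4) ∞]

theorem mfderiv_proj_symmDeriv {z : R4 × R3}
    (hz : z ∈ ((chartAt (ModelProd R4 R3) p₀).extend I7).target) (v : R4 × R3) :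
    mfderiv I7 (𝓡 4) (π R3 Z.Fiber) (((chartAt (ModelProd R4 R3) p₀).extend I7).symm z)
        (symmDeriv I7 (chartAt (ModelProd R4 R3) p₀) z v)
      = symmDeriv (𝓡 4) (chartAt R4 p₀.proj) z.1 v.1 := by
  have h1 := mfderiv_comp_apply z
    ((Bundle.contMDiff_proj (n := 1) (IB := 𝓡 4) Z.Fiber).mdifferentiableAt one_ne_zero)
    (mdifferentiableAt_extend_symm I7 (chart_mem_atlas _ p₀) hz) v
  have hz1 : z.1 ∈ ((chartAt R4 p₀.proj).extend (𝓡 4)).target := by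
    rw [totalChart_target] at hz
    exact hz.1.1
  have hev : π R3 Z.Fiber ∘ ((chartAt (ModelProd R4 R3) p₀).extend I7).symm =ᶠ[nhds z]
      ((chartAt R4 p₀.proj).extend (𝓡 4)).symm ∘ Prod.fst := by
    filter_upwards [(chartAt (ModelProd R4 R3) p₀).isOpen_extend_target.mem_nhds hz] with y hy
    exact totalChart_symm_proj p₀ hy
  have h2 := mfderiv_comp_apply (I := 𝓘(ℝ, R4 × R3)) (I' := 𝓘(ℝ, R4)) (f := Prod.fst) z
    (mdifferentiableAt_extend_symm (𝓡 4) (chart_mem_atlas R4 p₀.proj) hz1)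
    differentiableAt_fst.mdifferentiableAt v
  rw [hev.mfderiv_eq] at h1
  refine h1.symm.trans (h2.trans ?_)
  rw [mfderiv_eq_fderiv, fderiv_fst]
  rfl

theorem mdifferentiableAt_localTriv_snd (j : ι) {p : TotalSpace R3 Z.Fiber}
    (hp : p.proj ∈ Z.baseSet j) :
    MDifferentiableAt I7 𝓘(ℝ, R3) (fun q => (Z.localTriv j q).2) p := by
  have : MemTrivializationAtlas (Z.localTriv j) := ⟨⟨j, rfl⟩⟩
  have h := (Bundle.Trivialization.contMDiffOn (n := 1) (IB := 𝓡 4) (Z.localTriv j)).contMDiffAt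
    ((Z.localTriv j).open_source.mem_nhds ((Z.localTriv j).mem_source.mpr hp))
  exact (contMDiffAt_snd.comp p h).mdifferentiableAt one_ne_zero

/-- Along a single fibre the change of trivialisation is the linear map `Z.coordChange`, which is
its own derivative. -/
theorem mvfderiv_localTriv_symmDeriv (j : ι) {z : R4 × R3}
    (hz : z ∈ ((chartAt (ModelProd R4 R3) p₀).extend I7).target)
    (hj : ((chartAt R4 p₀.proj).extend (𝓡 4)).symm z.1 ∈ Z.baseSet j) (w : R3) :
    mvfderiv I7 (fun q => (Z.localTriv j q).2)
        (((chartAt (ModelProd R4 R3) p₀).extend I7).symm z)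
        (symmDeriv I7 (chartAt (ModelProd R4 R3) p₀) z (0, w))
      = Z.coordChange (Z.indexAt p₀.proj) j (((chartAt R4 p₀.proj).extend (𝓡 4)).symm z.1) w := by
  have hproj := totalChart_symm_proj p₀ hz
  have hmd := mdifferentiableAt_localTriv_snd (Z := Z) j (hproj ▸ hj)
  rw [mvfderiv_symmDeriv I7 (chart_mem_atlas _ p₀) hz hmd]
  have hd : DifferentiableAt ℝ ((fun q => (Z.localTriv j q).2)
      ∘ ((chartAt (ModelProd R4 R3) p₀).extend I7).symm) z :=
    (hmd.comp z (mdifferentiableAt_extend_symm I7 (chart_mem_atlas _ p₀) hz)).differentiableAt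
  have hline : HasFDerivAt (fun t : R3 => (z.1, t)) (ContinuousLinearMap.inr ℝ R4 R3) z.2 :=
    hasFDerivAt_prodMk_right z.1 z.2
  have hcomp := hd.hasFDerivAt.comp z.2 hline
  have hfun : ((fun q => (Z.localTriv j q).2) ∘ ((chartAt (ModelProd R4 R3) p₀).extend I7).symm)
      ∘ (fun t : R3 => (z.1, t)) = Z.coordChange (Z.indexAt p₀.proj) j
        (((chartAt R4 p₀.proj).extend (𝓡 4)).symm z.1) := by
    ext1 t
    have hzt : (z.1, t) ∈ ((chartAt (ModelProd R4 R3) p₀).extend I7).target := by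
      rw [totalChart_target] at hz ⊢
      exact ⟨hz.1, mem_univ _⟩
    have hbase : (((chartAt (ModelProd R4 R3) p₀).extend I7).symm (z.1, t)).proj
        ∈ Z.baseSet (Z.indexAt p₀.proj) ∩ Z.baseSet j := by
      rw [totalChart_symm_proj p₀ hzt]
      rw [totalChart_target] at hzt
      exact ⟨hzt.1.2, hj⟩
    simp only [Function.comp_apply]
    rw [localTriv_coordChange _ j hbase, totalChart_symm_apply p₀ hzt,
      totalChart_symm_proj p₀ hzt]
  rw [hfun] at hcomp
  have := hcomp.unique (ContinuousLinearMap.hasFDerivAt _)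
  exact congrArg (fun N => N w) this

variable (A : SO3Connection Z)

theorem covDeriv_symmDeriv (j : ι) {z : R4 × R3}
    (hz : z ∈ ((chartAt (ModelProd R4 R3) p₀).extend I7).target)
    (hj : ((chartAt R4 p₀.proj).extend (𝓡 4)).symm z.1 ∈ Z.baseSet j) (w : R3) :
    A.covDeriv j (((chartAt (ModelProd R4 R3) p₀).extend I7).symm z)
        (symmDeriv I7 (chartAt (ModelProd R4 R3) p₀) z (0, w))
      = Z.coordChange (Z.indexAt p₀.proj) j (((chartAt R4 p₀.proj).extend (𝓡 4)).symm z.1) w := by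
  have h1 := mfderiv_proj_symmDeriv p₀ hz (0, w)
  have h2 := congrArg (fun t => A.form j _ t ⨯₃
    (Z.localTriv j (((chartAt (ModelProd R4 R3) p₀).extend I7).symm z)).2) (h1.trans (map_zero _))
  have h3 : A.form j (((chartAt (ModelProd R4 R3) p₀).extend I7).symm z).proj 0 = 0 := map_zero _
  rw [h3, map_zero] at h2
  exact (congrArg₂ (· + ·) (mvfderiv_localTriv_symmDeriv p₀ j hz hj w) h2).trans (add_zero _)

end Bundle

end Connection


/-! ### Curvature as a bilinear form, and the splitting of the tangent spaces of the total space. -/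

section Connection

variable {M : Type*} [TopologicalSpace M] [ChartedSpace R4 M] {ι : Type*}
  [IsManifold (𝓡 4) ∞ M] {Z : VectorBundleCore ℝ M R3 ι} (A : SO3Connection Z)

theorem extDeriv1_add_left (a : ∀ x : M, TangentSpace (𝓡 4) x →L[ℝ] R3) (x : M)
    (v v' w : TangentSpace (𝓡 4) x) :
    extDeriv1 a x (v + v') w = extDeriv1 a x v w + extDeriv1 a x v' w := by
  have h : ∀ (D : R4 →L[ℝ] R4 →L[ℝ] R3) (l : TangentSpace (𝓡 4) x →L[ℝ] R4),
      D (l (v + v')) (l w) - D (l w) (l (v + v'))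
        = (D (l v) (l w) - D (l w) (l v)) + (D (l v') (l w) - D (l w) (l v')) := by
    intro D l
    simp only [map_add, _root_.add_apply]
    abel
  exact h _ (mfderiv (𝓡 4) 𝓘(ℝ, R4) (extChartAt (𝓡 4) x) x)

theorem extDeriv1_smul_left (a : ∀ x : M, TangentSpace (𝓡 4) x →L[ℝ] R3) (x : M) (r : ℝ)
    (v w : TangentSpace (𝓡 4) x) : extDeriv1 a x (r • v) w = r • extDeriv1 a x v w := by
  have h : ∀ (D : R4 →L[ℝ] R4 →L[ℝ] R3) (l : TangentSpace (𝓡 4) x →L[ℝ] R4),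
      D (l (r • v)) (l w) - D (l w) (l (r • v)) = r • (D (l v) (l w) - D (l w) (l v)) := by
    intro D l
    simp only [map_smul, _root_.smul_apply, smul_sub]
  exact h _ (mfderiv (𝓡 4) 𝓘(ℝ, R4) (extChartAt (𝓡 4) x) x)

theorem extDeriv1_swap (a : ∀ x : M, TangentSpace (𝓡 4) x →L[ℝ] R3) (x : M)
    (v w : TangentSpace (𝓡 4) x) : extDeriv1 a x w v = -extDeriv1 a x v w := by
  simp only [extDeriv1, neg_sub]

theorem curvature_add_left (a : ι) (x : M) (v v' w : TangentSpace (𝓡 4) x) :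
    A.curvature a x (v + v') w = A.curvature a x v w + A.curvature a x v' w := by
  unfold SO3Connection.curvature
  rw [extDeriv1_add_left, map_add, map_add, LinearMap.add_apply]
  abel

theorem curvature_smul_left (a : ι) (x : M) (r : ℝ) (v w : TangentSpace (𝓡 4) x) :
    A.curvature a x (r • v) w = r • A.curvature a x v w := by
  unfold SO3Connection.curvature
  rw [extDeriv1_smul_left, map_smul, map_smul, LinearMap.smul_apply, smul_add]

theorem curvature_swap (a : ι) (x : M) (v w : TangentSpace (𝓡 4) x) :
    A.curvature a x w v = -A.curvature a x v w := by
  unfold SO3Connection.curvature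
  rw [extDeriv1_swap, ← cross_anticomm, neg_add]

/-- The curvature component `F^i` at `x` as a bilinear form. -/
noncomputable def curvatureForm (i : Fin 3) (x : M) : LinearMap.BilinForm ℝ (TangentSpace (𝓡 4) x) :=
  LinearMap.mk₂ ℝ (A.F i x)
    (fun v v' w => congrFun (curvature_add_left A _ x v v' w) i)
    (fun r v w => congrFun (curvature_smul_left A _ x r v w) i)
    (fun v w w' => by
      have h : A.curvature (Z.indexAt x) x v (w + w') = A.curvature (Z.indexAt x) x v w
          + A.curvature (Z.indexAt x) x v w' := by
        rw [curvature_swap, curvature_add_left, curvature_swap A _ x v, curvature_swap A _ x v]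
        abel
      exact congrFun h i)
    (fun r v w => by
      have h : A.curvature (Z.indexAt x) x v (r • w) = r • A.curvature (Z.indexAt x) x v w := by
        rw [curvature_swap, curvature_smul_left, curvature_swap A _ x v]
        module
      exact congrFun h i)

theorem curvatureForm_self (i : Fin 3) (x : M) (v : TangentSpace (𝓡 4) x) :
    curvatureForm A i x v v = 0 := by
  have h := congrFun (curvature_swap A (Z.indexAt x) x v v) i
  rw [Pi.neg_apply] at h
  change A.curvature (Z.indexAt x) x v v i = 0
  linarith

variable [Z.IsContMDiff (𝓡 4) ∞]

/-- The splitting of a tangent space of the total space into its horizontal and vertical parts. -/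
noncomputable def splitMap (p : TotalSpace R3 Z.Fiber) :
    TangentSpace I7 p →ₗ[ℝ] TangentSpace (𝓡 4) p.proj × R3 where
  toFun ξ := (mfderiv I7 (𝓡 4) (π R3 Z.Fiber) p ξ, A.covDeriv (Z.indexAt p.proj) p ξ)
  map_add' ξ η := by
    refine Prod.ext (map_add _ _ _) ?_
    simp only [SO3Connection.covDeriv, map_add, LinearMap.add_apply, Prod.snd_add]
    abel
  map_smul' r ξ := by
    refine Prod.ext (map_smul _ _ _) ?_
    simp only [SO3Connection.covDeriv, map_smul, LinearMap.smul_apply, Prod.smul_snd, smul_add,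
      RingHom.id_apply]

theorem symmDeriv_bijective {c : OpenPartialHomeomorph M R4} (hc : c ∈ atlas R4 M) {u : R4}
    (hu : u ∈ (c.extend (𝓡 4)).target) : Function.Bijective (symmDeriv (𝓡 4) c u) := by
  have hx : (c.extend (𝓡 4)).symm u ∈ c.source := by
    have := (c.extend (𝓡 4)).map_target hu
    rwa [c.extend_source] at this
  have hinj : Function.Injective (symmDeriv (𝓡 4) c u) := by
    have hleft : ∀ p, mvfderiv (𝓡 4) (c.extend (𝓡 4)) ((c.extend (𝓡 4)).symm u)
        (symmDeriv (𝓡 4) c u p) = p := by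
      intro p
      rw [mvfderiv_symmDeriv (𝓡 4) hc hu (mdifferentiableAt_extend (𝓡 4) hc hx)]
      have hev : c.extend (𝓡 4) ∘ (c.extend (𝓡 4)).symm =ᶠ[nhds u] id := by
        filter_upwards [c.isOpen_extend_target.mem_nhds hu] with y hy
        exact (c.extend (𝓡 4)).right_inv hy
      rw [hev.fderiv_eq, fderiv_id]
      rfl
    exact Function.LeftInverse.injective hleft
  exact ⟨hinj, (LinearMap.injective_iff_surjective (f := (symmDeriv (𝓡 4) c u).toLinearMap)).mp hinj⟩

variable (p₀ : TotalSpace R3 Z.Fiber)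

theorem splitMap_symmDeriv {z : R4 × R3}
    (hz : z ∈ ((chartAt (ModelProd R4 R3) p₀).extend I7).target) (w : R3) :
    splitMap A (((chartAt (ModelProd R4 R3) p₀).extend I7).symm z)
        (symmDeriv I7 (chartAt (ModelProd R4 R3) p₀) z (0, w))
      = (0, Z.coordChange (Z.indexAt p₀.proj)
          (Z.indexAt (((chartAt (ModelProd R4 R3) p₀).extend I7).symm z).proj)
          (((chartAt (ModelProd R4 R3) p₀).extend I7).symm z).proj w) := by
  refine Prod.ext ((mfderiv_proj_symmDeriv p₀ hz (0, w)).trans (map_zero _)) ?_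
  have hp := totalChart_symm_proj p₀ hz
  refine (covDeriv_symmDeriv p₀ A _ hz ?_ w).trans ?_
  · rw [← hp]
    exact Z.mem_baseSet_at _
  · rw [← hp]

/-- Vertical vectors project to zero, so the matrix is block triangular and the connection only
enters the off-diagonal block. The vertical block is a transition matrix in SO(3), of determinant
one. -/
theorem det_splitCoord (hZ : IsSO3 Z) {z : R4 × R3}
    (hz : z ∈ ((chartAt (ModelProd R4 R3) p₀).extend I7).target) :
    (Matrix.of fun i k => splitCoord (frameBasis _)
        (splitMap A (((chartAt (ModelProd R4 R3) p₀).extend I7).symm z))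
        (symmDeriv I7 (chartAt (ModelProd R4 R3) p₀) z (stdBasis7 k)) i).det
      = (symmDeriv (𝓡 4) (chartAt R4 p₀.proj) z.1).det := by
  set p := ((chartAt (ModelProd R4 R3) p₀).extend I7).symm z with hpdef
  have hp := totalChart_symm_proj p₀ hz
  have hbase : p.proj ∈ Z.baseSet (Z.indexAt p₀.proj) ∩ Z.baseSet (Z.indexAt p.proj) := by
    refine ⟨?_, Z.mem_baseSet_at _⟩
    rw [totalChart_target] at hz
    rw [hp]
    exact hz.1.2
  set C : Matrix (Fin 3) (Fin 4) ℝ := Matrix.of fun i k =>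
    (splitMap A p (symmDeriv I7 (chartAt (ModelProd R4 R3) p₀) z (stdBasis7 (Sum.inl k)))).2 i
  have hblock : (Matrix.of fun i k => splitCoord (frameBasis _) (splitMap A p)
        (symmDeriv I7 (chartAt (ModelProd R4 R3) p₀) z (stdBasis7 k)) i)
      = Matrix.fromBlocks
        (LinearMap.toMatrix stdBasis4 stdBasis4 (symmDeriv (𝓡 4) (chartAt R4 p₀.proj) z.1).toLinearMap)
        0 C (LinearMap.toMatrix' (Z.coordChange (Z.indexAt p₀.proj) (Z.indexAt p.proj) p.proj :
          R3 →ₗ[ℝ] R3)) := by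
    have hinl : ∀ k, stdBasis7 (Sum.inl k) = (stdBasis4 k, 0) := fun k => by
      simp [stdBasis7]
    have hinr : ∀ k, stdBasis7 (Sum.inr k) = (0, Pi.single k 1) := fun k => by
      simp [stdBasis7]
    ext i k
    rcases i with i | i <;> rcases k with k | k
    · rw [Matrix.fromBlocks_apply₁₁, LinearMap.toMatrix_apply, Matrix.of_apply, hinl]
      have := mfderiv_proj_symmDeriv p₀ hz (stdBasis4 k, 0)
      exact congrArg (fun v : R4 => stdBasis4.repr v i) this
    · rw [Matrix.fromBlocks_apply₁₂, Matrix.of_apply, hinr]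
      have := splitMap_symmDeriv A p₀ hz (Pi.single k 1)
      simp only [splitCoord, Sum.elim_inl]
      rw [this]
      simp
    · rw [Matrix.fromBlocks_apply₂₁]
      rfl
    · rw [Matrix.fromBlocks_apply₂₂, Matrix.of_apply, hinr]
      have := splitMap_symmDeriv A p₀ hz (Pi.single k 1)
      simp only [splitCoord, Sum.elim_inr]
      rw [this]
      rw [LinearMap.toMatrix'_apply]
      rfl
  rw [hblock, Matrix.det_fromBlocks_zero₁₂, det_coordChange hZ hbase, mul_one,
    LinearMap.det_toMatrix]

theorem splitMap_bijective (hZ : IsSO3 Z) (p : TotalSpace R3 Z.Fiber) :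
    Function.Bijective (splitMap A p) := by
  have hmem : p ∈ (chartAt (ModelProd R4 R3) p).source := mem_chart_source _ _
  set z := (chartAt (ModelProd R4 R3) p).extend I7 p
  have hz : z ∈ ((chartAt (ModelProd R4 R3) p).extend I7).target :=
    ((chartAt (ModelProd R4 R3) p).extend I7).map_source
      (by rwa [OpenPartialHomeomorph.extend_source])
  have hdet := det_splitCoord A p hZ hz
  have hpz : ((chartAt (ModelProd R4 R3) p).extend I7).symm z = p :=
    (chartAt (ModelProd R4 R3) p).extend_left_inv hmem
  rw [← hpz]
  have hz1 : z.1 ∈ ((chartAt R4 p.proj).extend (𝓡 4)).target := by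
    rw [totalChart_target] at hz
    exact hz.1.1
  have hsurj : Function.Surjective
      (splitMap A (((chartAt (ModelProd R4 R3) p).extend I7).symm z)) := by
    rintro ⟨v, w⟩
    obtain ⟨v', hv'⟩ := (symmDeriv_bijective (chart_mem_atlas R4 p.proj) hz1).2 v
    set q := ((chartAt (ModelProd R4 R3) p).extend I7).symm z with hq
    have hbase : q.proj ∈ Z.baseSet (Z.indexAt p.proj) := by
      rw [totalChart_target] at hz
      rw [totalChart_symm_proj p (by rw [totalChart_target]; exact hz)]
      exact hz.1.2
    set d := (splitMap A q (symmDeriv I7 (chartAt (ModelProd R4 R3) p) z (v', 0))).2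
    -- Lift `v` arbitrarily through the chart, then correct the resulting fibre component `d` by a
    -- vertical vector.
    refine ⟨symmDeriv I7 (chartAt (ModelProd R4 R3) p) z (v', 0)
      + symmDeriv I7 (chartAt (ModelProd R4 R3) p) z
        (0, Z.coordChange (Z.indexAt q.proj) (Z.indexAt p.proj) q.proj (w - d)), ?_⟩
    refine ((splitMap A q).map_add _ _).trans ?_
    rw [splitMap_symmDeriv A p hz]
    refine Prod.ext ?_ ?_
    · exact (add_zero _).trans ((mfderiv_proj_symmDeriv p hz (v', 0)).trans hv')
    · rw [Z.coordChange_comp _ _ _ _ ⟨⟨Z.mem_baseSet_at _, hbase⟩, Z.mem_baseSet_at _⟩,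
        Z.coordChange_self _ _ (Z.mem_baseSet_at _)]
      exact add_sub_cancel d w
  refine ⟨?_, hsurj⟩
  have hfd1 : FiniteDimensional ℝ (TangentSpace I7 (((chartAt (ModelProd R4 R3) p).extend I7).symm z)) :=
    inferInstanceAs (FiniteDimensional ℝ (R4 × R3))
  have hfd2 : FiniteDimensional ℝ (TangentSpace (𝓡 4)
      (((chartAt (ModelProd R4 R3) p).extend I7).symm z).proj × R3) :=
    inferInstanceAs (FiniteDimensional ℝ (R4 × R3))
  exact (LinearMap.injective_iff_surjective_of_finrank_eq_finrank rfl).mpr hsurj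

end Connection


theorem wedge22_eq_det_mul {V : Type*} [AddCommGroup V] [Module ℝ V]
    (b : Module.Basis (Fin 4) ℝ V) (G H : LinearMap.BilinForm ℝ V) (hG : ∀ v, G v v = 0)
    (hH : ∀ v, H v v = 0) (v : Fin 4 → V) :
    wedge22 (fun v w => G v w) (fun v w => H v w) v
      = (b.toMatrix v).det * wedge22 (fun v w => G v w) (fun v w => H v w) b := by
  simp only [wedge22]
  rw [alternating_bilin_eq b G hG (v 0) (v 1), alternating_bilin_eq b G hG (v 0) (v 2),
    alternating_bilin_eq b G hG (v 0) (v 3), alternating_bilin_eq b G hG (v 1) (v 2),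
    alternating_bilin_eq b G hG (v 1) (v 3), alternating_bilin_eq b G hG (v 2) (v 3),
    alternating_bilin_eq b H hH (v 0) (v 1), alternating_bilin_eq b H hH (v 0) (v 2),
    alternating_bilin_eq b H hH (v 0) (v 3), alternating_bilin_eq b H hH (v 1) (v 2),
    alternating_bilin_eq b H hH (v 1) (v 3), alternating_bilin_eq b H hH (v 2) (v 3),
    Matrix.det_succ_row_zero]
  simp only [wedge11, Fin.sum_univ_four, Matrix.det_fin_three, Matrix.submatrix_apply,
    Module.Basis.toMatrix_apply]
  simp [Fin.succAbove]
  ring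

/-! ### The metric of the 3-form at a point of the total space. -/

section Connection

variable {M : Type*} [TopologicalSpace M] [ChartedSpace R4 M] {ι : Type*}
  [IsManifold (𝓡 4) ∞ M] {Z : VectorBundleCore ℝ M R3 ι} [Z.IsContMDiff (𝓡 4) ∞]
  (A : SO3Connection Z) (ε : ∀ x : M, TangentSpace (𝓡 4) x [⋀^Fin 4]→ₗ[ℝ] ℝ)

theorem wedge22_F_frame (hA : A.IsDefiniteWith ε) (i j : Fin 3) (x : M) :
    wedge22 (A.F i x) (A.F j x) (frame x) = -2 * A.X ε x i j * ε x (frame x) := by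
  have hne : ε x (frame x) ≠ 0 := by
    intro h
    exact (hA x).1 (((ε x).map_basis_eq_zero_iff (frameBasis x)).mp h)
  rw [SO3Connection.X, Matrix.of_apply]
  field_simp

theorem exists_isG2Metric_Omega (hZ : IsSO3 Z) (hA : A.IsDefiniteWith ε) {σ : ℝ}
    (hσ : A.HasSign ε σ) {p : TotalSpace R3 Z.Fiber} (hp : p ∈ domain Z σ) :
    ∃ g, IsG2Metric (Omega A σ p) g ∧
      ∀ v : Fin 4 ⊕ Fin 3 → TangentSpace I7 p, √(Matrix.of fun k l => g (v k) (v l)).det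
        = 4 * (1 + σ * ySq Z p) ^ (1 / 4 : ℝ) * (A.X ε p.proj).det ^ (1 / 3 : ℝ)
          * |ε p.proj (frame p.proj)|
          * |(Matrix.of fun i k => splitCoord (frameBasis p.proj) (splitMap A p) (v k) i).det| := by
  have hpos : 0 < 1 + σ * ySq Z p := hp
  set f := (1 + σ * ySq Z p) ^ (1 / 4 : ℝ) with hf
  have hf0 : 0 < f := Real.rpow_pos_of_pos hpos _
  have hf3 : (f ^ 3)⁻¹ = (1 + σ * ySq Z p) ^ (-3 / 4 : ℝ) := by
    rw [hf, ← Real.rpow_natCast, ← Real.rpow_mul hpos.le, ← Real.rpow_neg hpos.le]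
    norm_num
  have hframe : frame p.proj 0 ≠ 0 := (frameBasis p.proj).ne_zero 0
  -- Of the sign condition only the value on the first frame vector is needed.
  obtain ⟨g, hg, hv⟩ := exists_isG2Metric (frameBasis p.proj)
    (LinearEquiv.ofBijective (splitMap A p) (splitMap_bijective A hZ p))
    (fun i => curvatureForm A i p.proj) (fun i v => curvatureForm_self A i p.proj v)
    (ε p.proj (frame p.proj)) (A.X ε p.proj) (hA p.proj).2
    (fun i j => wedge22_F_frame A ε hA i j p.proj) σ hσ.1
    (hσ.2 p.proj (frame p.proj 0) hframe) f hf0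
  refine ⟨g, ?_, hv⟩
  rw [hf3] at hg
  exact hg

end Connection


/-! ### The densities of the metric and of the base action, and measurability of the latter. -/

theorem alternating_apply_eq {V κ : Type*} [AddCommGroup V] [Module ℝ V] [Fintype κ]
    [DecidableEq κ] (b : Module.Basis κ ℝ V) (e : V [⋀^κ]→ₗ[ℝ] ℝ) (v : κ → V) :
    e v = (b.toMatrix v).det * e b := by
  conv_lhs => rw [e.eq_smul_basis_det b]
  rw [AlternatingMap.smul_apply, Module.Basis.det_apply, smul_eq_mul, mul_comm]

theorem toMatrix_sum_smul {V κ : Type*} [AddCommGroup V] [Module ℝ V] [Fintype κ]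
    (b : Module.Basis κ ℝ V) (v : κ → V) (N : Matrix κ κ ℝ) :
    b.toMatrix (fun k => ∑ l, N l k • v l) = b.toMatrix v * N := by
  ext i k
  simp [Module.Basis.toMatrix_apply, Matrix.mul_apply, map_sum, mul_comm]

theorem isDensity_gram {E H M κ : Type*} [NormedAddCommGroup E] [NormedSpace ℝ E]
    [TopologicalSpace H] [TopologicalSpace M] [ChartedSpace H M]
    [Fintype κ] [DecidableEq κ] (I : ModelWithCorners ℝ E H)
    (g : ∀ x : M, LinearMap.BilinForm ℝ (TangentSpace I x)) :
    IsDensity (κ := κ) I fun x v => √(Matrix.of fun k l => g x (v k) (v l)).det := by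
  intro x v N
  have h : (Matrix.of fun k l => g x (∑ m, N m k • v m) (∑ m, N m l • v m))
      = Nᵀ * (Matrix.of fun k l => g x (v k) (v l)) * N := by
    ext k l
    simp only [Matrix.of_apply, map_sum, map_smul, LinearMap.sum_apply, LinearMap.smul_apply,
      smul_eq_mul, Matrix.mul_apply, Matrix.transpose_apply, Finset.sum_mul, Finset.mul_sum]
    refine Finset.sum_congr rfl fun i _ => Finset.sum_congr rfl fun j _ => ?_
    ring
  simp only
  rw [h, Matrix.det_mul, Matrix.det_mul, Matrix.det_transpose, mul_right_comm, ← sq,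
    Real.sqrt_mul (sq_nonneg _), Real.sqrt_sq_eq_abs]

section Connection

variable {M : Type*} [TopologicalSpace M] [ChartedSpace R4 M] {ι : Type*}
  [IsManifold (𝓡 4) ∞ M] {Z : VectorBundleCore ℝ M R3 ι}
  (A : SO3Connection Z) (ε : ∀ x : M, TangentSpace (𝓡 4) x [⋀^Fin 4]→ₗ[ℝ] ℝ)

theorem isDensity_action :
    IsDensity (𝓡 4) fun x v => (A.X ε x).det ^ (1 / 3 : ℝ) * |ε x v| := by
  intro x v N
  simp only
  rw [alternating_apply_eq (frameBasis x) (ε x), toMatrix_sum_smul, Matrix.det_mul,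
    alternating_apply_eq (frameBasis x) (ε x) v]
  simp only [abs_mul]
  ring

theorem det_toMatrix_symmDeriv (c : OpenPartialHomeomorph M R4) (u : R4) :
    ((frameBasis ((c.extend (𝓡 4)).symm u)).toMatrix
      (fun k => symmDeriv (𝓡 4) c u (stdBasis4 k))).det = (symmDeriv (𝓡 4) c u).det := by
  refine Eq.trans (congrArg Matrix.det ?_)
    (LinearMap.det_toMatrix stdBasis4 (symmDeriv (𝓡 4) c u).toLinearMap)
  ext i j
  rw [LinearMap.toMatrix_apply]
  rfl

theorem chartDensity_action_eq (c : OpenPartialHomeomorph M R4) (u : R4) :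
    chartDensity (𝓡 4) stdBasis4 (fun x v => (A.X ε x).det ^ (1 / 3 : ℝ) * |ε x v|) c u
      = ENNReal.ofReal ((A.X ε ((c.extend (𝓡 4)).symm u)).det ^ (1 / 3 : ℝ)
        * (|(symmDeriv (𝓡 4) c u).det|
          * |ε ((c.extend (𝓡 4)).symm u) (frame ((c.extend (𝓡 4)).symm u))|)) := by
  have h := alternating_apply_eq (frameBasis ((c.extend (𝓡 4)).symm u))
    (ε ((c.extend (𝓡 4)).symm u)) (fun k => symmDeriv (𝓡 4) c u (stdBasis4 k))
  rw [det_toMatrix_symmDeriv] at h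
  have h2 := (congrArg abs h).trans (abs_mul _ _)
  exact congrArg (fun t => ENNReal.ofReal
    ((A.X ε ((c.extend (𝓡 4)).symm u)).det ^ (1 / 3 : ℝ) * t)) h2

/-- The components of `-(1/2) F^i ∧ F^j` in the coordinates of a chart and a trivialisation. -/
noncomputable def localX (a : ι) (c : OpenPartialHomeomorph M R4) (u : R4) :
    Matrix (Fin 3) (Fin 3) ℝ :=
  Matrix.of fun i j => -(1 / 2) * wedge22 (fun p q => localCurv A a c u p q i)
    (fun p q => localCurv A a c u p q j) stdBasis4

theorem continuousOn_localX (a : ι) {c : OpenPartialHomeomorph M R4} (hc : c ∈ atlas R4 M) :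
    ContinuousOn (localX A a c) (coordDomain Z a c) := by
  have h0 := (contDiffOn_localForm A a hc).continuousOn
  have h1 := (contDiffOn_localForm A a hc).continuousOn_fderiv_of_isOpen
    (isOpen_coordDomain a c) (by simp)
  have hcurv : ∀ p q, ContinuousOn (fun u => localCurv A a c u p q) (coordDomain Z a c) := by
    intro p q
    have h2 : ∀ p, ContinuousOn (fun u => localForm A a c u p) (coordDomain Z a c) := fun p =>
      h0.clm_apply continuousOn_const
    have h3 : ∀ p q, ContinuousOn (fun u => fderiv ℝ (localForm A a c) u p q)
        (coordDomain Z a c) := fun p q =>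
      (h1.clm_apply continuousOn_const).clm_apply continuousOn_const
    refine ((h3 p q).sub (h3 q p)).add ?_
    have h4 : ∀ p i, ContinuousOn (fun u => localForm A a c u p i) (coordDomain Z a c) :=
      fun p i => (continuous_apply i).comp_continuousOn (h2 p)
    refine continuousOn_pi.mpr fun i => ?_
    simp only [cross_apply]
    fin_cases i
    · exact ((h4 p 1).mul (h4 q 2)).sub ((h4 p 2).mul (h4 q 1))
    · exact ((h4 p 2).mul (h4 q 0)).sub ((h4 p 0).mul (h4 q 2))
    · exact ((h4 p 0).mul (h4 q 1)).sub ((h4 p 1).mul (h4 q 0))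
  have hcomp : ∀ p q i, ContinuousOn (fun u => localCurv A a c u p q i) (coordDomain Z a c) :=
    fun p q i => (continuous_apply i).comp_continuousOn (hcurv p q)
  refine continuousOn_pi.mpr fun i => continuousOn_pi.mpr fun j => ?_
  refine continuousOn_const.mul ?_
  have hm : ∀ p q r s, ContinuousOn (fun u => localCurv A a c u p q i * localCurv A a c u r s j)
    (coordDomain Z a c) := fun p q r s => (hcomp p q i).mul (hcomp r s j)
  exact ((((((hm _ _ _ _).sub (hm _ _ _ _)).add (hm _ _ _ _)).add (hm _ _ _ _)).sub
    (hm _ _ _ _)).add (hm _ _ _ _))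

variable [Z.IsContMDiff (𝓡 4) ∞]

theorem F_symmDeriv (hZ : IsSO3 Z) (a : ι) {c : OpenPartialHomeomorph M R4}
    (hc : c ∈ atlas R4 M) {u : R4} (hu : u ∈ coordDomain Z a c) (i : Fin 3) (p q : R4) :
    A.F i ((c.extend (𝓡 4)).symm u) (symmDeriv (𝓡 4) c u p) (symmDeriv (𝓡 4) c u q)
      = Z.coordChange a (Z.indexAt ((c.extend (𝓡 4)).symm u)) ((c.extend (𝓡 4)).symm u)
        (localCurv A a c u p q) i := by
  have hu' : u ∈ coordDomain Z (Z.indexAt ((c.extend (𝓡 4)).symm u)) c :=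
    ⟨hu.1, Z.mem_baseSet_at _⟩
  rw [← localCurv_coordChange A hZ a _ hc hu hu' p q]
  exact congrFun (curvature_symmDeriv A _ hc hu' p q) i

/-- Up to a rotation, the local matrix of `-(1/2) Fⁱ∧Fʲ` is `X` times the value of `ε` on the
coordinate frame. In rank 3 that scalar comes out of the determinant cubed. -/
theorem det_localX (hZ : IsSO3 Z) (hA : A.IsDefiniteWith ε) (a : ι)
    {c : OpenPartialHomeomorph M R4} (hc : c ∈ atlas R4 M) {u : R4}
    (hu : u ∈ coordDomain Z a c) :
    (localX A a c u).det = (A.X ε ((c.extend (𝓡 4)).symm u)).det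
      * ((symmDeriv (𝓡 4) c u).det
        * ε ((c.extend (𝓡 4)).symm u) (frame ((c.extend (𝓡 4)).symm u))) ^ 3 := by
  set x := (c.extend (𝓡 4)).symm u with hx
  set O := LinearMap.toMatrix' (Z.coordChange a (Z.indexAt x) x : R3 →ₗ[ℝ] R3) with hO
  set d := (symmDeriv (𝓡 4) c u).det
  have hdet : O.det = 1 := det_coordChange hZ ⟨hu.2, Z.mem_baseSet_at _⟩
  have hv : ∀ w : R3, Z.coordChange a (Z.indexAt x) x w = O *ᵥ w := fun w => by
    rw [hO, LinearMap.toMatrix'_mulVec]; rfl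
  have hmat : O * localX A a c u * Oᵀ = (d * ε x (frame x)) • A.X ε x := by
    ext i j
    have h1 := wedge22_eq_det_mul (frameBasis x) (curvatureForm A i x) (curvatureForm A j x)
      (curvatureForm_self A i x) (curvatureForm_self A j x)
      (fun k => symmDeriv (𝓡 4) c u (stdBasis4 k))
    rw [det_toMatrix_symmDeriv] at h1
    have h2 : wedge22 (fun p q => (O *ᵥ localCurv A a c u p q) i)
        (fun p q => (O *ᵥ localCurv A a c u p q) j) stdBasis4
        = d * (-2 * A.X ε x i j * ε x (frame x)) := by
      rw [← wedge22_F_frame A ε hA i j x]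
      refine Eq.trans ?_ h1
      have h3 : ∀ i p q, (O *ᵥ localCurv A a c u p q) i
          = A.F i x (symmDeriv (𝓡 4) c u p) (symmDeriv (𝓡 4) c u q) := fun i p q => by
        rw [← hv]; exact (F_symmDeriv A hZ a hc hu i p q).symm
      simp only [h3]
      rfl
    have h4 : (O * localX A a c u * Oᵀ) i j
        = -(1 / 2) * wedge22 (fun p q => (O *ᵥ localCurv A a c u p q) i)
        (fun p q => (O *ᵥ localCurv A a c u p q) j) stdBasis4 := by
      simp only [Matrix.mul_apply, Matrix.transpose_apply, localX, Matrix.of_apply, Matrix.mulVec,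
        dotProduct, Fin.sum_univ_three, wedge22]
      ring
    rw [h4, h2, Matrix.smul_apply, smul_eq_mul]
    ring
  have h := congrArg Matrix.det hmat
  rw [Matrix.det_mul, Matrix.det_mul, Matrix.det_transpose, hdet, Matrix.det_smul] at h
  simp only [Fintype.card_fin, one_mul, mul_one] at h
  rw [h]
  ring

/-- The exponent `1/3` undoes the cube in `det_localX`, so `ε` drops out. The density is thus
continuous in the coordinates, although no regularity of `ε` is assumed. -/
theorem chartDensity_action (hZ : IsSO3 Z) (hA : A.IsDefiniteWith ε) (a : ι)
    {c : OpenPartialHomeomorph M R4} (hc : c ∈ atlas R4 M) {u : R4}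
    (hu : u ∈ coordDomain Z a c) :
    chartDensity (𝓡 4) stdBasis4 (fun x v => (A.X ε x).det ^ (1 / 3 : ℝ) * |ε x v|) c u
      = ENNReal.ofReal (|(localX A a c u).det| ^ (1 / 3 : ℝ)) := by
  rw [chartDensity_action_eq, det_localX A ε hZ hA a hc hu, abs_mul, abs_pow, abs_mul,
    abs_of_pos (hA _).2.det_pos,
    Real.mul_rpow (hA _).2.det_pos.le (by positivity), ← Real.rpow_natCast,
    ← Real.rpow_mul (by positivity)]
  norm_num

theorem aemeasurable_chartDensity_action (hZ : IsSO3 Z) (hA : A.IsDefiniteWith ε) (a : ι)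
    {c : OpenPartialHomeomorph M R4} (hc : c ∈ atlas R4 M) {D : Set R4} (hD : MeasurableSet D)
    (hDc : D ⊆ coordDomain Z a c) (μ : Measure R4) :
    AEMeasurable (chartDensity (𝓡 4) stdBasis4
      (fun x v => (A.X ε x).det ^ (1 / 3 : ℝ) * |ε x v|) c) (μ.restrict D) := by
  have h1 : ContinuousOn (fun u => |(localX A a c u).det| ^ (1 / 3 : ℝ)) D := by
    have h2 : ContinuousOn (fun u => (localX A a c u).det) D :=
      (continuous_id.matrix_det).comp_continuousOn ((continuousOn_localX A a hc).mono hDc)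
    exact h2.abs.rpow_const fun _ _ => Or.inr (by norm_num)
  refine ((h1.aemeasurable hD).ennreal_ofReal).congr ?_
  filter_upwards [ae_restrict_mem hD] with u hu
  exact (chartDensity_action A ε hZ hA a hc (hDc hu)).symm

end Connection


/-! ### The volume of the total space. -/

section Connection

variable {M : Type*} [TopologicalSpace M] [ChartedSpace R4 M] {ι : Type*}
  {Z : VectorBundleCore ℝ M R3 ι}

theorem continuous_ySq (hZ : IsSO3 Z) : Continuous (ySq Z) := by
  rw [continuous_iff_continuousAt]
  intro p
  have hopen : π R3 Z.Fiber ⁻¹' Z.baseSet (Z.indexAt p.proj) ∈ nhds p :=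
    ((Z.isOpen_baseSet _).preimage Z.continuous_proj).mem_nhds (Z.mem_baseSet_at _)
  have hev : (fun q => (Z.localTriv (Z.indexAt p.proj) q).2 ⬝ᵥ
      (Z.localTriv (Z.indexAt p.proj) q).2) =ᶠ[nhds p] ySq Z := by
    filter_upwards [hopen] with q hq
    exact (ySq_eq hZ _ hq).symm
  refine ContinuousAt.congr ?_ hev
  have h : ContinuousAt (Z.localTriv (Z.indexAt p.proj)) p :=
    (Z.localTriv (Z.indexAt p.proj)).toOpenPartialHomeomorph.continuousAt
      ((Z.localTriv _).mem_source.mpr (Z.mem_baseSet_at _))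
  have h2 : ContinuousAt (fun q => (Z.localTriv (Z.indexAt p.proj) q).2) p :=
    continuous_snd.continuousAt.comp h
  exact (Continuous.dotProduct continuous_id continuous_id).continuousAt.comp h2

theorem isOpen_domain (hZ : IsSO3 Z) (σ : ℝ) : IsOpen (domain Z σ) :=
  isOpen_lt continuous_const (continuous_const.add (continuous_const.mul (continuous_ySq hZ)))

theorem ySq_totalChart_symm (hZ : IsSO3 Z) (p₀ : TotalSpace R3 Z.Fiber) {z : R4 × R3}
    (hz : z ∈ ((chartAt (ModelProd R4 R3) p₀).extend I7).target) :
    ySq Z (((chartAt (ModelProd R4 R3) p₀).extend I7).symm z) = z.2 ⬝ᵥ z.2 := by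
  have hb : (((chartAt (ModelProd R4 R3) p₀).extend I7).symm z).proj
      ∈ Z.baseSet (Z.indexAt p₀.proj) := by
    rw [totalChart_symm_proj p₀ hz]
    rw [totalChart_target] at hz
    exact hz.1.2
  rw [ySq_eq hZ _ hb, totalChart_symm_apply p₀ hz]

/-- The part of the fibre on which the 3-form is defined. -/
def fibreDomain (σ : ℝ) : Set R3 := {y : R3 | 0 < 1 + σ * (y ⬝ᵥ y)}

theorem isOpen_fibreDomain (σ : ℝ) : IsOpen (fibreDomain σ) :=
  isOpen_lt continuous_const (continuous_const.add (continuous_const.mul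
    (Continuous.dotProduct continuous_id continuous_id)))

theorem totalChart_inter_preimage (hZ : IsSO3 Z) (σ : ℝ) (p₀ : TotalSpace R3 Z.Fiber) {V : Set M}
    (hV : V ⊆ Z.baseSet (Z.indexAt p₀.proj)) :
    ((chartAt (ModelProd R4 R3) p₀).extend I7).target ∩
        ((chartAt (ModelProd R4 R3) p₀).extend I7).symm ⁻¹'
          (domain Z σ ∩ π R3 Z.Fiber ⁻¹' V)
      = (((chartAt R4 p₀.proj).extend (𝓡 4)).target ∩
          ((chartAt R4 p₀.proj).extend (𝓡 4)).symm ⁻¹' (univ ∩ V)) ×ˢ fibreDomain σ := by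
  ext z
  have key : z ∈ ((chartAt (ModelProd R4 R3) p₀).extend I7).target →
      ((((chartAt (ModelProd R4 R3) p₀).extend I7).symm z ∈ domain Z σ ↔ z.2 ∈ fibreDomain σ) ∧
      (((chartAt (ModelProd R4 R3) p₀).extend I7).symm z ∈ π R3 Z.Fiber ⁻¹' V ↔
        ((chartAt R4 p₀.proj).extend (𝓡 4)).symm z.1 ∈ V)) := by
    intro hz
    constructor
    · change 0 < 1 + σ * ySq Z _ ↔ _
      rw [ySq_totalChart_symm hZ p₀ hz]
      exact Iff.rfl
    · change TotalSpace.proj _ ∈ V ↔ _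
      rw [totalChart_symm_proj p₀ hz]
  constructor
  · rintro ⟨hz, h1, h2⟩
    have hz' := hz
    rw [totalChart_target] at hz'
    exact ⟨⟨hz'.1.1, mem_univ _, (key hz).2.mp h2⟩, (key hz).1.mp h1⟩
  · rintro ⟨⟨h1, -, h2⟩, h3⟩
    have hz : z ∈ ((chartAt (ModelProd R4 R3) p₀).extend I7).target := by
      rw [totalChart_target]
      exact ⟨⟨h1, hV h2⟩, mem_univ _⟩
    exact ⟨hz, (key hz).1.mpr h3, (key hz).2.mpr h2⟩

variable [IsManifold (𝓡 4) ∞ M] [Z.IsContMDiff (𝓡 4) ∞]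
  (A : SO3Connection Z) (ε : ∀ x : M, TangentSpace (𝓡 4) x [⋀^Fin 4]→ₗ[ℝ] ℝ)

theorem chartDensity_total (hZ : IsSO3 Z) (hA : A.IsDefiniteWith ε) {σ : ℝ}
    (hσ : A.HasSign ε σ)
    (g : ∀ p : TotalSpace R3 Z.Fiber, LinearMap.BilinForm ℝ (TangentSpace I7 p))
    (hg : ∀ p ∈ domain Z σ, IsG2Metric (Omega A σ p) (g p)) (p₀ : TotalSpace R3 Z.Fiber)
    {z : R4 × R3} (hz : z ∈ ((chartAt (ModelProd R4 R3) p₀).extend I7).target)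
    (hd : ((chartAt (ModelProd R4 R3) p₀).extend I7).symm z ∈ domain Z σ) :
    chartDensity I7 stdBasis7 (fun x v => √(Matrix.of fun k l => g x (v k) (v l)).det)
        (chartAt (ModelProd R4 R3) p₀) z
      = chartDensity (𝓡 4) stdBasis4 (fun x v => (A.X ε x).det ^ (1 / 3 : ℝ) * |ε x v|)
          (chartAt R4 p₀.proj) z.1
        * ENNReal.ofReal (4 * (1 + σ * (z.2 ⬝ᵥ z.2)) ^ (1 / 4 : ℝ)) := by
  obtain ⟨g', hg', hv⟩ := exists_isG2Metric_Omega A ε hZ hA hσ hd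
  -- Uniqueness transfers the determinant formula from the constructed metric to the given `g`,
  -- about which nothing else is known.
  have hgg := isG2Metric_unique (hg _ hd) hg'
  have h1 := hv (fun k => symmDeriv I7 (chartAt (ModelProd R4 R3) p₀) z (stdBasis7 k))
  rw [← hgg, det_splitCoord A p₀ hZ hz, ySq_totalChart_symm hZ p₀ hz] at h1
  have h2 := congrArg (fun x => (A.X ε x).det ^ (1 / 3 : ℝ) * |ε x (frame x)|)
    (totalChart_symm_proj p₀ hz)
  rw [mul_assoc (4 * _), h2] at h1
  refine (congrArg ENNReal.ofReal h1).trans ?_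
  rw [chartDensity_action_eq, ← ENNReal.ofReal_mul (mul_nonneg
    (Real.rpow_nonneg (hA _).2.det_pos.le _) (by positivity))]
  congr 1
  ring

/-- In bundle coordinates the region, the Lebesgue measure and the integrand are all products of a
base and a fibre factor, so Tonelli applies. -/
theorem lintegral_chartDensity_total (hZ : IsSO3 Z) (hA : A.IsDefiniteWith ε) {σ : ℝ}
    (hσ : A.HasSign ε σ)
    (g : ∀ p : TotalSpace R3 Z.Fiber, LinearMap.BilinForm ℝ (TangentSpace I7 p))
    (hg : ∀ p ∈ domain Z σ, IsG2Metric (Omega A σ p) (g p)) (p₀ : TotalSpace R3 Z.Fiber)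
    [MeasurableSpace M] [BorelSpace M] {V : Set M} (hVm : MeasurableSet V)
    (hV : V ⊆ Z.baseSet (Z.indexAt p₀.proj)) :
    ∫⁻ z in ((chartAt (ModelProd R4 R3) p₀).extend I7).target ∩
        ((chartAt (ModelProd R4 R3) p₀).extend I7).symm ⁻¹'
          (domain Z σ ∩ π R3 Z.Fiber ⁻¹' V),
        chartDensity I7 stdBasis7 (fun x v => √(Matrix.of fun k l => g x (v k) (v l)).det)
          (chartAt (ModelProd R4 R3) p₀) z ∂stdBasis7.addHaar
      = 4 * fibreIntegral σ * ∫⁻ u in ((chartAt R4 p₀.proj).extend (𝓡 4)).target ∩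
          ((chartAt R4 p₀.proj).extend (𝓡 4)).symm ⁻¹' (univ ∩ V),
        chartDensity (𝓡 4) stdBasis4 (fun x v => (A.X ε x).det ^ (1 / 3 : ℝ) * |ε x v|)
          (chartAt R4 p₀.proj) u ∂stdBasis4.addHaar := by
  have hD := measurableSet_target_inter_preimage (𝓡 4) (chartAt R4 p₀.proj)
    (MeasurableSet.univ.inter hVm)
  have hset := totalChart_inter_preimage hZ σ p₀ hV
  have hB := (isOpen_fibreDomain σ).measurableSet
  set D := ((chartAt R4 p₀.proj).extend (𝓡 4)).target ∩
    ((chartAt R4 p₀.proj).extend (𝓡 4)).symm ⁻¹' (univ ∩ V) with hDdef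
  have hDc : D ⊆ coordDomain Z (Z.indexAt p₀.proj) (chartAt R4 p₀.proj) :=
    fun u hu => ⟨hu.1, hV hu.2.2⟩
  have hcongr : ∀ z ∈ D ×ˢ fibreDomain σ,
      chartDensity I7 stdBasis7 (fun x v => √(Matrix.of fun k l => g x (v k) (v l)).det)
          (chartAt (ModelProd R4 R3) p₀) z = _ := fun z hz =>
    chartDensity_total A ε hZ hA hσ g hg p₀ (z := z) (hset.symm.subset hz).1
      (hset.symm.subset hz).2.1
  have hmeas : stdBasis7.addHaar = stdBasis4.addHaar.prod (volume : Measure R3) := by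
    rw [stdBasis7, Module.Basis.prod_addHaar]
    congr 1
    rw [Module.Basis.addHaar_def, Module.Basis.parallelepiped_basisFun, addHaarMeasure_eq_volume_pi]
  rw [hset, setLIntegral_congr_fun (hD.prod hB) hcongr, hmeas, ← Measure.prod_restrict]
  refine (lintegral_prod_mul
    (g := fun y : R3 => ENNReal.ofReal (4 * (1 + σ * (y ⬝ᵥ y)) ^ (1 / 4 : ℝ)))
    (aemeasurable_chartDensity_action A ε hZ hA (Z.indexAt p₀.proj)
      (chart_mem_atlas R4 p₀.proj) hD hDc _) ?_).trans ?_
  rotate_left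
  · rw [mul_comm]
    congr 1
    rw [fibreIntegral, ← lintegral_const_mul' _ _ (by norm_num)]
    refine lintegral_congr fun y => ?_
    rw [ENNReal.ofReal_mul (by norm_num)]
    norm_num
  · refine Measurable.aemeasurable ?_
    refine ENNReal.measurable_ofReal.comp (Measurable.const_mul ?_ _)
    refine Measurable.pow_const ?_ _
    exact (continuous_const.add (continuous_const.mul
      (Continuous.dotProduct continuous_id continuous_id))).measurable

theorem riemannianVolume_eq [SecondCountableTopology M] [MeasurableSpace M] [BorelSpace M]
    [MeasurableSpace (TotalSpace R3 Z.Fiber)] [BorelSpace (TotalSpace R3 Z.Fiber)]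
    (hZ : IsSO3 Z) (hA : A.IsDefiniteWith ε) {σ : ℝ}
    (hσ : A.HasSign ε σ)
    (g : ∀ p : TotalSpace R3 Z.Fiber, LinearMap.BilinForm ℝ (TangentSpace I7 p))
    (hg : ∀ p ∈ domain Z σ, IsG2Metric (Omega A σ p) (g p)) :
    riemannianVolume I7 stdBasis7 (domain Z σ) g = 4 * fibreIntegral σ * action4 A ε := by
  -- The countable cover below is enumerated by `ℕ`, which needs a point of `M`.
  rcases isEmpty_or_nonempty M with hM | hM
  · have : IsEmpty (TotalSpace R3 Z.Fiber) := ⟨fun p => hM.elim p.proj⟩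
    rw [riemannianVolume, action4, densityIntegral, densityIntegral, univ_eq_empty_iff.mpr hM,
      univ_eq_empty_iff.mpr this, measure_empty, measure_empty, mul_zero]
  -- Charts of the total space live over the intersection of a base chart domain with a trivialising
  -- set. Countably many such sets cover `M`, and making them disjoint partitions the base and, by
  -- preimage, the total space.
  obtain ⟨s, hs, hsu⟩ := TopologicalSpace.countable_cover_nhds
    (f := fun x : M => (chartAt R4 x).source ∩ Z.baseSet (Z.indexAt x)) fun x =>
    Filter.inter_mem ((chartAt R4 x).open_source.mem_nhds (mem_chart_source _ x))
      ((Z.isOpen_baseSet _).mem_nhds (Z.mem_baseSet_at x))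
  have hsne : s.Nonempty := by
    obtain ⟨y⟩ := hM
    have hy : y ∈ ⋃ x ∈ s, (chartAt R4 x).source ∩ Z.baseSet (Z.indexAt x) :=
      hsu.symm.subset (mem_univ y)
    obtain ⟨x, hx, -⟩ := mem_iUnion₂.mp hy
    exact ⟨x, hx⟩
  obtain ⟨x, rfl⟩ := hs.exists_eq_range hsne
  set W : ℕ → Set M := fun n => (chartAt R4 (x n)).source ∩ Z.baseSet (Z.indexAt (x n)) with hW
  have hWu : ⋃ n, W n = univ := by rw [← hsu, biUnion_range]
  have hWm : ∀ n, MeasurableSet (W n) := fun n =>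
    ((chartAt R4 (x n)).open_source.inter (Z.isOpen_baseSet _)).measurableSet
  have hVm : ∀ n, MeasurableSet (disjointed W n) := fun n => MeasurableSet.disjointed hWm n
  have hVu : ⋃ n, disjointed W n = univ := iUnion_disjointed.trans hWu
  have hproj : Measurable (π R3 Z.Fiber) := Z.continuous_proj.measurable
  rw [riemannianVolume, action4, densityIntegral_eq_tsum (𝓡 4) stdBasis4 _ (isDensity_action A ε)
      MeasurableSet.univ (disjointed W) (fun n => chartAt R4 (x n))
      (fun n => chart_mem_atlas _ _) hVm (disjoint_disjointed W)
      (fun n => (disjointed_subset W n).trans inter_subset_left) hVu,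
    densityIntegral_eq_tsum I7 stdBasis7 _ (isDensity_gram I7 g)
      (isOpen_domain hZ σ).measurableSet (fun n => π R3 Z.Fiber ⁻¹' disjointed W n)
      (fun n => chartAt (ModelProd R4 R3) (⟨x n, 0⟩ : TotalSpace R3 Z.Fiber))
      (fun n => chart_mem_atlas _ _) (fun n => hproj (hVm n))
      (fun a b hab => (disjoint_disjointed W hab).preimage _)
      (fun n => by
        rw [totalChart_source]
        exact preimage_mono (disjointed_subset W n))
      (by rw [← preimage_iUnion, hVu, preimage_univ]),
    ← ENNReal.tsum_mul_left]
  exact tsum_congr fun n => lintegral_chartDensity_total A ε hZ hA hσ g hg ⟨x n, 0⟩ (hVm n)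
    ((disjointed_subset W n).trans inter_subset_right)

end Connection


/-! ### The fibre integral over the unit ball -/

/-- The radial profile of the fibre integrand over the unit ball. -/
noncomputable def ballProfile (r : ℝ) : ℝ := max (1 - r ^ 2) 0 ^ (1 / 4 : ℝ)

theorem ballProfile_nonneg (r : ℝ) : 0 ≤ ballProfile r :=
  Real.rpow_nonneg (le_max_right _ _) _

theorem integral_betaPDFReal {a b : ℝ} (ha : 0 < a) (hb : 0 < b) :
    ∫ x, ProbabilityTheory.betaPDFReal a b x = 1 := by
  rw [integral_eq_lintegral_of_nonneg_ae]
  · have h := ProbabilityTheory.lintegral_betaPDF_eq_one ha hb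
    simp only [ProbabilityTheory.betaPDF] at h
    rw [h, ENNReal.toReal_one]
  · refine Filter.Eventually.of_forall fun x => ?_
    by_cases hx : 0 < x ∧ x < 1
    · exact (ProbabilityTheory.betaPDFReal_pos hx.1 hx.2 ha hb).le
    · simp [ProbabilityTheory.betaPDFReal, hx]
  · exact (ProbabilityTheory.measurable_betaPDFReal a b).aestronglyMeasurable

/-- The substitution `t = r²` turns the radial integral into `(1/2) ∫ t^(1/2) (1-t)^(1/4) dt` over
the unit interval. Its value is known from the normalisation of the beta distribution. -/
theorem integral_Ioi_ballProfile :
    ∫ r in Ioi (0 : ℝ), r ^ 2 * ballProfile r = ProbabilityTheory.beta (3 / 2) (5 / 4) / 2 := by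
  have hB : 0 < ProbabilityTheory.beta (3 / 2) (5 / 4) :=
    ProbabilityTheory.beta_pos (by norm_num) (by norm_num)
  set B := ProbabilityTheory.beta (3 / 2) (5 / 4) with hBdef
  set g : ℝ → ℝ := fun t => B / 2 * ProbabilityTheory.betaPDFReal (3 / 2) (5 / 4) t with hg
  have h1 := integral_comp_rpow_Ioi_of_pos (g := g) (p := 2) (by norm_num)
  have h2 : ∫ t in Ioi (0 : ℝ), g t = B / 2 := by
    rw [setIntegral_eq_integral_of_forall_compl_eq_zero, hg, integral_const_mul,
      integral_betaPDFReal (by norm_num) (by norm_num), mul_one]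
    intro x hx
    have : ¬ (0 < x ∧ x < 1) := fun h => hx h.1
    simp [hg, ProbabilityTheory.betaPDFReal, this]
  rw [← h2, ← h1]
  refine setIntegral_congr_fun measurableSet_Ioi fun r hr => ?_
  have hr0 : (0 : ℝ) < r := hr
  simp only [hg, ballProfile, smul_eq_mul, ProbabilityTheory.betaPDFReal]
  have e1 : r ^ (2 : ℝ) = r ^ 2 := Real.rpow_two r
  have e2 : (r ^ 2) ^ (3 / 2 - 1 : ℝ) = r := by
    rw [← Real.rpow_two, ← Real.rpow_mul hr0.le]
    norm_num
  rw [e1, ← hBdef]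
  by_cases h : r ^ 2 < 1
  · rw [if_pos ⟨by positivity, h⟩, max_eq_left (by linarith), e2]
    norm_num
    field_simp
  · rw [if_neg fun h' => h h'.2, max_eq_right (by linarith), Real.zero_rpow (by norm_num)]
    simp

theorem integral_ballProfile_norm :
    ∫ x : EuclideanSpace ℝ (Fin 3), ballProfile ‖x‖
      = 2 * Real.pi * ProbabilityTheory.beta (3 / 2) (5 / 4) := by
  have h := integral_fun_norm_addHaar (volume : Measure (EuclideanSpace ℝ (Fin 3))) ballProfile
  have hG : Real.Gamma (3 / 2 + 1) = 3 / 4 * √Real.pi := by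
    rw [Real.Gamma_add_one (by norm_num), show (3 / 2 : ℝ) = 1 / 2 + 1 by norm_num,
      Real.Gamma_add_one (by norm_num), Real.Gamma_one_half_eq]
    ring
  have hpi : (0 : ℝ) < √Real.pi := Real.sqrt_pos.mpr Real.pi_pos
  have hvol : (volume : Measure (EuclideanSpace ℝ (Fin 3))).real (Metric.ball 0 1)
      = 4 / 3 * Real.pi := by
    rw [Measure.real, EuclideanSpace.volume_ball]
    simp only [Fintype.card_fin, ENNReal.ofReal_one, one_pow, one_mul, Nat.cast_ofNat]
    rw [hG, ENNReal.toReal_ofReal (by positivity)]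
    have : √Real.pi ^ 3 = Real.pi * √Real.pi := by
      rw [pow_succ, Real.sq_sqrt Real.pi_pos.le]
    rw [this]
    field_simp
  rw [h, hvol]
  simp only [finrank_euclideanSpace, Fintype.card_fin, smul_eq_mul, nsmul_eq_mul]
  rw [integral_Ioi_ballProfile]
  push_cast
  ring

theorem beta_three_halves_five_quarters :
    2 * Real.pi * ProbabilityTheory.beta (3 / 2) (5 / 4)
      = 4 * √Real.pi * Real.Gamma (1 / 4) ^ 2 / (21 * √2) := by
  have h1 : Real.Gamma (3 / 2) = √Real.pi / 2 := by
    rw [show (3 / 2 : ℝ) = 1 / 2 + 1 by norm_num,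
      Real.Gamma_add_one (by norm_num), Real.Gamma_one_half_eq]
    ring
  have h2 : Real.Gamma (5 / 4) = Real.Gamma (1 / 4) / 4 := by
    rw [show (5 / 4 : ℝ) = 1 / 4 + 1 by norm_num, Real.Gamma_add_one (by norm_num)]
    ring
  have h3 : Real.Gamma (3 / 2 + 5 / 4) = 21 / 16 * Real.Gamma (3 / 4) := by
    rw [show (3 / 2 + 5 / 4 : ℝ) = 3 / 4 + 1 + 1 by norm_num, Real.Gamma_add_one (by norm_num),
      Real.Gamma_add_one (by norm_num)]
    ring
  -- Euler's reflection formula eliminates `Γ(3/4)` in favour of `Γ(1/4)`.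
  have h4 : Real.Gamma (1 / 4) * Real.Gamma (3 / 4) = Real.pi * √2 := by
    have h := Real.Gamma_mul_Gamma_one_sub (1 / 4)
    rw [show (1 - 1 / 4 : ℝ) = 3 / 4 by norm_num,
      show Real.pi * (1 / 4) = Real.pi / 4 by ring, Real.sin_pi_div_four] at h
    rw [h]
    have : √2 * √2 = 2 := Real.mul_self_sqrt (by norm_num)
    field_simp
    linarith
  have hG : 0 < Real.Gamma (1 / 4) := Real.Gamma_pos_of_pos (by norm_num)
  have hG3 : 0 < Real.Gamma (3 / 4) := Real.Gamma_pos_of_pos (by norm_num)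
  rw [ProbabilityTheory.beta, h1, h2, h3]
  have hs : (0 : ℝ) < √2 := by positivity
  field_simp
  linear_combination -16 * h4

theorem fibreIntegral_neg_one :
    fibreIntegral (-1)
      = ENNReal.ofReal (4 * √Real.pi * Real.Gamma (1 / 4) ^ 2 / (21 * √2)) := by
  have hG : 0 < Real.Gamma (1 / 4) := Real.Gamma_pos_of_pos (by norm_num)
  have hval := integral_ballProfile_norm.trans beta_three_halves_five_quarters
  have hpos : 0 < 4 * √Real.pi * Real.Gamma (1 / 4) ^ 2 / (21 * √2) := by
    have := Real.pi_pos
    positivity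
  -- The Bochner integral of a non-integrable function is zero by default, so the positive value
  -- already computed forces integrability.
  have hint : Integrable (fun x : EuclideanSpace ℝ (Fin 3) => ballProfile ‖x‖) := by
    by_contra h
    rw [integral_undef h] at hval
    exact hpos.ne hval
  -- The norm of `Fin 3 → ℝ` is the sup norm, so the polar computation took place in
  -- `EuclideanSpace`; the identification of the two spaces preserves volume.
  rw [← hval, ofReal_integral_eq_lintegral_ofReal hint
    (Filter.Eventually.of_forall fun x => ballProfile_nonneg _),
    ← (PiLp.volume_preserving_toLp (Fin 3)).lintegral_comp_emb
      (MeasurableEquiv.toLp 2 (Fin 3 → ℝ)).measurableEmbedding]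
  change ∫⁻ y in fibreDomain (-1), _ = _
  rw [← lintegral_indicator (isOpen_fibreDomain (-1)).measurableSet]
  refine lintegral_congr fun y => ?_
  have hn : ‖(WithLp.toLp 2 y : EuclideanSpace ℝ (Fin 3))‖ ^ 2 = y ⬝ᵥ y := by
    rw [EuclideanSpace.real_norm_sq_eq]
    simp [dotProduct, sq]
  rw [ballProfile, hn]
  by_cases hy : y ∈ fibreDomain (-1)
  · have hy' : 0 < 1 + -1 * (y ⬝ᵥ y) := hy
    rw [indicator_of_mem hy, max_eq_left (by linarith)]
    congr 2
    ring
  · have hy' : ¬ 0 < 1 + -1 * (y ⬝ᵥ y) := hy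
    rw [indicator_of_notMem hy, max_eq_right (by linarith), Real.zero_rpow (by norm_num),
      ENNReal.ofReal_zero]

end G2Lift

theorem mainTheorem2 {M : Type*} [TopologicalSpace M] [ChartedSpace G2Lift.R4 M]
    [IsManifold (𝓡 4) ∞ M] [T2Space M] [SecondCountableTopology M]
    [MeasurableSpace M] [BorelSpace M]
    {ι : Type*} (Z : VectorBundleCore ℝ M G2Lift.R3 ι) [Z.IsContMDiff (𝓡 4) ∞]
    (hZ : G2Lift.IsSO3 Z)
    [MeasurableSpace (TotalSpace G2Lift.R3 Z.Fiber)] [BorelSpace (TotalSpace G2Lift.R3 Z.Fiber)]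
    (A : G2Lift.SO3Connection Z)
    (ε : ∀ x : M, TangentSpace (𝓡 4) x [⋀^Fin 4]→ₗ[ℝ] ℝ)
    (hA : A.IsDefiniteWith ε) (σ : ℝ) (hσ : A.HasSign ε σ) :
    (∀ p ∈ G2Lift.domain Z σ, ∃! g, G2Lift.IsG2Metric (G2Lift.Omega A σ p) g) ∧
    (∀ g : ∀ p : TotalSpace G2Lift.R3 Z.Fiber,
        LinearMap.BilinForm ℝ (TangentSpace G2Lift.I7 p),
      (∀ p ∈ G2Lift.domain Z σ, G2Lift.IsG2Metric (G2Lift.Omega A σ p) (g p)) →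
      G2Lift.riemannianVolume G2Lift.I7 G2Lift.stdBasis7 (G2Lift.domain Z σ) g
          = 4 * G2Lift.fibreIntegral σ * G2Lift.action4 A ε ∧
      (σ = -1 →
        G2Lift.fibreIntegral σ < ⊤ ∧
        G2Lift.riemannianVolume G2Lift.I7 G2Lift.stdBasis7 (G2Lift.domain Z σ) g
          = ENNReal.ofReal (16 * √Real.pi * Real.Gamma (1 / 4) ^ 2 / (21 * √2))
            * G2Lift.action4 A ε)) := by
  refine ⟨fun p hp => ?_, fun g hg => ?_⟩
  · obtain ⟨g, hg, -⟩ := G2Lift.exists_isG2Metric_Omega A ε hZ hA hσ hp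
    exact ⟨g, hg, fun g' hg' => G2Lift.isG2Metric_unique hg' hg⟩
  · have hvol := G2Lift.riemannianVolume_eq A ε hZ hA hσ g hg
    refine ⟨hvol, ?_⟩
    rintro rfl
    refine ⟨by rw [G2Lift.fibreIntegral_neg_one]; exact ENNReal.ofReal_lt_top, ?_⟩
    rw [hvol, G2Lift.fibreIntegral_neg_one,
      show (4 : ℝ≥0∞) = ENNReal.ofReal 4 by norm_num, ← ENNReal.ofReal_mul (by norm_num)]
    congr 2
    ring
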